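/- Let $n\ge 2$ and let $\mathrm{Aut}(\mathbb{C}^n)$ be the group of holomorphic automorphisms of $\mathbb{C}^n$ with the compact-open topology. An overshear in direction of the $n$-th coordinate axis is a map $$(z_1,\dots,z_n)\mapsto\bigl(z_1,\dots,z_{n-1},\ e^{f(z_1,\dots,z_{n-1})}z_n+g(z_1,\dots,z_{n-1})\bigr)$$ with $f,g$ entire on $\mathbb{C}^{n-1}$; it is a shear in that direction if $f\equiv 0$. The overshears (shears) of $\mathbb{C}^n$ are the conjugates $A^{-1}\circ F\circ A$ of such maps $F$ by matrices $A\in \mathrm{SL}_n(\mathbb{C})$, and the overshear group (shear group) is the subgroup of $\mathrm{Aut}(\mathbb{C}^n)$ that they generate. Put $I(z_1,\dots,z_n)=(z_2,\dots,z_n,-(-1)^n z_1)$. A twisted overshear (twisted shear) is a map $G\circ I$, where $G$ is an overshear (shear). Theorem. Let $w\in\mathbb{C}^n\setminus\{0\}$ and let $\tau(z)=z+w$. (1) There is an $F\in\mathrm{Aut}(\mathbb{C}^n)$, conjugate to a twisted shear by an element of the shear group, such that the group $\langle\tau,F\rangle$ generated by $\tau$ and $F$ is a subgroup of the shear group, is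 free with free generators $\tau,F$, and is dense in the shear group in the compact-open topology. (2) There is an $F\in\mathrm{Aut}(\mathbb{C}^n)$, conjugate to a twisted overshear by an element of the overshear group, such that $\langle\tau,F\rangle$ is a subgroup of the overshear group, is free with free generators $\tau,F$, and is dense in the overshear group in the compact-open topology. -/

import Mathlib

/-- Complex Euclidean space of dimension `N`. -/
abbrev CSpace (N : ℕ) : Type := Fin N → ℂ

/-- The group of holomorphic automorphisms of `ℂ^N`: bijections that are holomorphic together
with their inverse. Multiplication is composition. -/
def HolAut (N : ℕ) : Subgroup (CSpace N ≃ₜ CSpace N) where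
  carrier := {F | Differentiable ℂ (F : CSpace N → CSpace N) ∧
    Differentiable ℂ (F.symm : CSpace N → CSpace N)}
  mul_mem' := by
    intro F G hF hG
    exact ⟨hF.1.comp hG.1, hG.2.comp hF.2⟩
  one_mem' := ⟨differentiable_id, differentiable_id⟩
  inv_mem' := by
    intro F hF
    exact ⟨hF.2, hF.1⟩

namespace HolAut

/-- An automorphism as a continuous self-map of `ℂ^N`. -/
noncomputable def toContinuousMap {N : ℕ} (F : HolAut N) : C(CSpace N, CSpace N) :=
  ⟨F.1, F.1.continuous⟩

/-- The compact-open topology on the automorphism group. -/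
noncomputable instance compactOpen (N : ℕ) : TopologicalSpace (HolAut N) :=
  TopologicalSpace.induced toContinuousMap inferInstance

/-- A pair of mutually inverse holomorphic maps, as an automorphism. -/
def mk' {N : ℕ} (u v : CSpace N → CSpace N) (hu : Differentiable ℂ u) (hv : Differentiable ℂ v)
    (huv : ∀ z, v (u z) = z) (hvu : ∀ z, u (v z) = z) : HolAut N :=
  ⟨{ toFun := u
     invFun := v
     left_inv := huv
     right_inv := hvu
     continuous_toFun := hu.continuous
     continuous_invFun := hv.continuous }, ⟨hu, hv⟩⟩

/-- The translation `z ↦ z + w`. -/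
def translation {N : ℕ} (w : CSpace N) : HolAut N :=
  mk' (fun z => z + w) (fun z => z - w) (by fun_prop) (by fun_prop)
    (fun z => add_sub_cancel_right z w) (fun z => sub_add_cancel z w)

open Matrix in
/-- The linear automorphism `z ↦ A z` for `A` in the special linear group. -/
def linear {N : ℕ} (A : Matrix.SpecialLinearGroup (Fin N) ℂ) : HolAut N :=
  mk' (fun z => A.1 *ᵥ z) (fun z => (A⁻¹).1 *ᵥ z)
    (by
      have h := (Matrix.mulVecLin A.1).toContinuousLinearMap.differentiable
      exact h)
    (by
      have h := (Matrix.mulVecLin (A⁻¹).1).toContinuousLinearMap.differentiable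
      exact h)
    (by
      intro z
      rw [Matrix.mulVec_mulVec, ← Matrix.SpecialLinearGroup.coe_mul, inv_mul_cancel]
      simp)
    (by
      intro z
      rw [Matrix.mulVec_mulVec, ← Matrix.SpecialLinearGroup.coe_mul, mul_inv_cancel]
      simp)

theorem differentiable_init {n : ℕ} :
    Differentiable ℂ (fun z : CSpace (n + 1) => (Fin.init z : CSpace n)) := by
  unfold Fin.init
  fun_prop

theorem differentiable_snoc {N n : ℕ} {u : CSpace N → CSpace n} {v : CSpace N → ℂ}
    (hu : Differentiable ℂ u) (hv : Differentiable ℂ v) :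
    Differentiable ℂ (fun z => (Fin.snoc (u z) (v z) : CSpace (n + 1))) := by
  rw [differentiable_pi]
  intro i
  refine Fin.lastCases ?_ (fun j => ?_) i
  · simpa using hv
  · simpa using (differentiable_pi.1 hu) j

theorem differentiable_cons {N n : ℕ} {u : CSpace N → CSpace n} {v : CSpace N → ℂ}
    (hu : Differentiable ℂ u) (hv : Differentiable ℂ v) :
    Differentiable ℂ (fun z => (Fin.cons (v z) (u z) : CSpace (n + 1))) := by
  rw [differentiable_pi]
  intro i
  refine Fin.cases ?_ (fun j => ?_) i
  · simpa using hv
  · simpa using (differentiable_pi.1 hu) j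

/-- The overshear in direction of the last coordinate axis of `ℂ^(n+1)`,
`(z', z_last) ↦ (z', exp (f z') * z_last + g z')`, for entire functions `f`, `g` on `ℂ^n`. -/
noncomputable def axisOvershear {n : ℕ} (f g : CSpace n → ℂ)
    (hf : Differentiable ℂ f) (hg : Differentiable ℂ g) : HolAut (n + 1) :=
  mk' (fun z => Fin.snoc (Fin.init z)
        (Complex.exp (f (Fin.init z)) * z (Fin.last n) + g (Fin.init z)))
    (fun z => Fin.snoc (Fin.init z)
        (Complex.exp (-f (Fin.init z)) * (z (Fin.last n) - g (Fin.init z))))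
    (by
      have h := differentiable_init (n := n)
      have h1 := hf.comp h
      have h2 := hg.comp h
      simp only [Function.comp_def] at h1 h2
      exact differentiable_snoc h ((h1.cexp.mul (by fun_prop)).add h2))
    (by
      have h := differentiable_init (n := n)
      have h1 := hf.comp h
      have h2 := hg.comp h
      simp only [Function.comp_def] at h1 h2
      exact differentiable_snoc h (h1.neg.cexp.mul (by fun_prop)))
    (by
      intro z
      simp [← mul_assoc, ← Complex.exp_add])
    (by
      intro z
      simp [← mul_assoc, ← Complex.exp_add])

/-- The shear in direction of the last coordinate axis, `(z', z_last) ↦ (z', z_last + g z')`. -/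
noncomputable def axisShear {n : ℕ} (g : CSpace n → ℂ) (hg : Differentiable ℂ g) :
    HolAut (n + 1) :=
  axisOvershear (fun _ => 0) g (differentiable_const 0) hg

/-- The overshears of `ℂ^(n+1)`: the conjugates under the special linear group of the overshears
in direction of the last coordinate axis. -/
def overshears (n : ℕ) : Set (HolAut (n + 1)) :=
  {G | ∃ (A : Matrix.SpecialLinearGroup (Fin (n + 1)) ℂ) (f g : CSpace n → ℂ)
      (hf : Differentiable ℂ f) (hg : Differentiable ℂ g),
      G = (linear A)⁻¹ * axisOvershear f g hf hg * linear A}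

/-- The shears of `ℂ^(n+1)`: the conjugates under the special linear group of the shears
in direction of the last coordinate axis. -/
def shears (n : ℕ) : Set (HolAut (n + 1)) :=
  {G | ∃ (A : Matrix.SpecialLinearGroup (Fin (n + 1)) ℂ) (g : CSpace n → ℂ)
      (hg : Differentiable ℂ g), G = (linear A)⁻¹ * axisShear g hg * linear A}

/-- The overshear group of `ℂ^(n+1)`. -/
noncomputable def overshearGroup (n : ℕ) : Subgroup (HolAut (n + 1)) := Subgroup.closure (overshears n)

/-- The shear group of `ℂ^(n+1)`. -/
noncomputable def shearGroup (n : ℕ) : Subgroup (HolAut (n + 1)) := Subgroup.closure (shears n)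

/-- The linear map `I (z_1, …, z_N) = (z_2, …, z_N, -(-1)^N z_1)` of `ℂ^N`, for `N = n + 1`. -/
def twist (n : ℕ) : HolAut (n + 1) :=
  mk' (fun z => Fin.snoc (Fin.tail z) (-(-1 : ℂ) ^ (n + 1) * z 0))
    (fun z => Fin.cons (-(-1 : ℂ) ^ (n + 1) * z (Fin.last n)) (Fin.init z))
    (differentiable_snoc (by unfold Fin.tail; fun_prop) (by fun_prop))
    (differentiable_cons differentiable_init (by fun_prop))
    (by
      intro z
      have h : (-1 : ℂ) ^ (n + 1) * (-1) ^ (n + 1) = 1 := by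
        rw [← mul_pow]; simp
      simp [← mul_assoc, h])
    (by
      intro z
      have h : (-1 : ℂ) ^ (n + 1) * (-1) ^ (n + 1) = 1 := by
        rw [← mul_pow]; simp
      simp [← mul_assoc, h])

/-- The twisted overshears `G ∘ I`, with `G` an overshear. -/
def twistedOvershears (n : ℕ) : Set (HolAut (n + 1)) :=
  {T | ∃ G ∈ overshears n, T = G * twist n}

/-- The twisted shears `G ∘ I`, with `G` a shear. -/
def twistedShears (n : ℕ) : Set (HolAut (n + 1)) :=
  {T | ∃ G ∈ shears n, T = G * twist n}

/-- `S` is conjugate to `T` by an element of the subgroup `H`. -/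
def ConjugateIn {N : ℕ} (H : Subgroup (HolAut N)) (S T : HolAut N) : Prop :=
  ∃ P ∈ H, S = P⁻¹ * T * P

/-- The group generated by `S` and `T` is contained in `H`, is free on the two generators
`S`, `T`, and is dense in `H` for the compact-open topology. -/
structure IsFreeDensePair {N : ℕ} (H : Subgroup (HolAut N)) (S T : HolAut N) : Prop where
  le : Subgroup.closure {S, T} ≤ H
  free : Function.Injective (FreeGroup.lift ![S, T])
  dense : Dense ((Subgroup.closure {S, T}).subgroupOf H : Set H)

end HolAut

/-!
The proof treats shears and overshears together, as overshears whose exponent `f` is taken from a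
class `𝓕` of entire functions (`IsExponentClass`): the zero function alone, or all of them.

*Density.* Since `SL_{n+1}` acts transitively on nonzero vectors (`exists_mulVec_eq`), the
translation vector may be taken to be `(1, 2, 4, …, 2 ^ n)` (`baseVector`). For this vector `w`,
`2 • w - twist w` is a multiple of the last coordinate vector, so that `τ ^ (2 * k) * F * τ ^ (-k)`
is again a twisted overshear when `F` is one, with parameters `f` and `g` translated by a
multiple of `k` and an explicit correction of `g` (`translation_pow_mul_twisted`). By a
construction in the manner of Birkhoff (`exists_entire_approx_translates`), entire functions `f` and
`g` can be prescribed approximately along a sparse sequence of translates. Letting the prescribed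
functions run through a dense sequence, one puts every product of an axis overshear with the twist
into the closure of the group generated by `τ` and `F` (`exists_axisOvershear_mul_twist_mem`).
This closure, taken for convergence together with the inverses (`biClosure`), is a group. It
contains the twist, hence all axis overshears; conjugation by the twist then yields all elementary
matrices, hence `SL_{n+1}` (`linear_mem_of_axisShear`) and all overshears
(`closure_overshearsIn_le`).

*Freeness.* The group obtained this way need not be free, so two perturbations enter `F`: the
parameter `g` is changed by `h₂` applied to the sum of the coordinates, and `F` is conjugated by a
shear `endShear` built from `h₁` (`twistedGenerator`). Both `h₁` and `h₂` decay along translations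
in the real direction, so that they disappear in the limits above and density persists whatever
they are. They are taken from a Banach space of coefficients (`decayingSeries`), on which the action
of a word in `τ` and `F` depends holomorphically. The coefficients for which a given word acts
trivially form a closed set. If this set had an interior point, the identity theorem on complex
lines would make the word act trivially for all coefficients; but along the orbit of a suitable
point under a reduced word each letter reads `h₁` and `h₂` at new points
(`WordModel.exists_eval_ne`), and by interpolation (`exists_decayingSeries_eqOn`) the values there
can be chosen so that the endpoint of the orbit differs from its starting point. Baire's theorem
gives coefficients for which no reduced word acts trivially (`exists_lift_injective`).
-/

open Filter Topology Metric BoundedContinuousFunction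

/-! ### Entire functions with prescribed behaviour along a sequence of translates -/

section Weierstrass

variable {E : Type*} [NormedAddCommGroup E] [NormedSpace ℂ E]

/-- Cauchy estimate for the Fréchet derivative, from the one-variable estimate on complex lines. -/
theorem norm_fderiv_le_of_norm_le_ball {f : E → ℂ} (hf : Differentiable ℂ f) {z : E} {r M : ℝ}
    (hr : 0 < r) (h : ∀ y ∈ ball z r, ‖f y‖ ≤ M) : ‖fderiv ℂ f z‖ ≤ 2 * M / r := by
  have hM : 0 ≤ M := (norm_nonneg _).trans (h z (mem_ball_self hr))
  refine ContinuousLinearMap.opNorm_le_bound _ (by positivity) fun v => ?_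
  rcases eq_or_ne v 0 with rfl | hv
  · simp
  have hv' : 0 < ‖v‖ := norm_pos_iff.2 hv
  have hd : Differentiable ℂ fun t : ℂ => f (z + t • v) := hf.comp (by fun_prop)
  have hR : 0 < r / (2 * ‖v‖) := by positivity
  have key := Complex.norm_deriv_le_of_forall_mem_sphere_norm_le (c := 0) (C := M) hR
    hd.diffContOnCl (fun t ht => h _ (by
      have ht' : ‖t‖ = r / (2 * ‖v‖) := by simpa using ht
      have : ‖t‖ * ‖v‖ = r / 2 := by rw [ht']; field_simp
      simp only [mem_ball, dist_self_add_left, norm_smul, this]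
      linarith))
  have hderiv : deriv (fun t : ℂ => f (z + t • v)) 0 = fderiv ℂ f z v := by
    have h1 : HasDerivAt (fun t : ℂ => z + t • v) v 0 := by
      simpa using ((hasDerivAt_id (0 : ℂ)).smul_const v).const_add z
    have h2 : HasFDerivAt f (fderiv ℂ f z) (z + (0 : ℂ) • v) := by
      simpa using (hf z).hasFDerivAt
    exact (h2.comp_hasDerivAt 0 h1).deriv
  rw [hderiv] at key
  refine key.trans (le_of_eq ?_)
  field_simp

/-- A series of entire functions on a normed space that locally admits, from some index on, a
summable bound has an entire sum. -/
theorem differentiable_tsum_of_locally_bounded {f : ℕ → E → ℂ} (hf : ∀ k, Differentiable ℂ (f k))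
    (h : ∀ z, ∃ r > 0, ∃ u : ℕ → ℝ, Summable u ∧ ∃ k₀, ∀ k ≥ k₀, ∀ y ∈ ball z r, ‖f k y‖ ≤ u k) :
    Differentiable ℂ fun z => ∑' k, f k z := by
  intro z
  obtain ⟨r, hr, u, hu, k₀, hk⟩ := h z
  have hr2 : 0 < r / 2 := half_pos hr
  have hsum : ∀ y ∈ ball z r, Summable fun k => f (k + k₀) y := fun y hy =>
    Summable.of_norm_bounded ((summable_nat_add_iff k₀).2 hu) fun k => hk _ (by omega) y hy
  have hu' : Summable fun k => 2 * u (k + k₀) / (r / 2) :=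
    (((summable_nat_add_iff k₀).2 hu).mul_left 2).div_const _
  have htail : DifferentiableAt ℂ (fun y => ∑' k, f (k + k₀) y) z := by
    let _ : NormedSpace ℝ E := NormedSpace.restrictScalars ℝ ℂ E
    refine (hasFDerivAt_tsum_of_isPreconnected hu' (isOpen_ball (x := z) (ε := r / 2))
      (convex_ball z (r / 2)).isPreconnected
      (fun k y _ => ((hf (k + k₀)) y).hasFDerivAt) (fun k y hy => ?_) (mem_ball_self hr2)
      (hsum z (mem_ball_self hr)) (mem_ball_self hr2)).differentiableAt
    refine norm_fderiv_le_of_norm_le_ball (hf _) hr2 fun y' hy' => hk _ (by omega) y' ?_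
    have h1 := mem_ball.1 hy
    have h2 := mem_ball.1 hy'
    exact mem_ball.2 ((dist_triangle y' y z).trans_lt (by linarith))
  have heq : (fun y => ∑' k, f k y) =ᶠ[𝓝 z]
      fun y => (∑ k ∈ Finset.range k₀, f k y) + ∑' k, f (k + k₀) y := by
    filter_upwards [ball_mem_nhds z hr] with y hy
    exact (((summable_nat_add_iff k₀).1 (hsum y hy)).sum_add_tsum_nat_add k₀).symm
  refine DifferentiableAt.congr_of_eventuallyEq ?_ heq
  refine DifferentiableAt.add ?_ htail
  fun_prop

end Weierstrass

section Switch

/-- The cubic `x ^ 2 * (3 - 2 * x)`, for which `0` and `1` are superattracting fixed points. -/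
def smoothStep (x : ℂ) : ℂ := x ^ 2 * (3 - 2 * x)

theorem smoothStep_one_sub (x : ℂ) : smoothStep (1 - x) = 1 - smoothStep x := by
  unfold smoothStep; ring

theorem smoothStep_iterate_one_sub (k : ℕ) (x : ℂ) :
    smoothStep^[k] (1 - x) = 1 - smoothStep^[k] x :=
  (Function.Semiconj.iterate_right (f := fun x => 1 - x)
    (fun x => (smoothStep_one_sub x).symm) k x).symm

theorem norm_smoothStep_le {x : ℂ} (hx : ‖x‖ ≤ 1 / 4) : ‖smoothStep x‖ ≤ 7 / 8 * ‖x‖ := by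
  have h1 : ‖3 - 2 * x‖ ≤ 7 / 2 := by
    refine (norm_sub_le _ _).trans ?_
    simp only [norm_mul, Complex.norm_ofNat]
    linarith
  rw [smoothStep, norm_mul, norm_pow]
  nlinarith [norm_nonneg x, norm_nonneg (3 - 2 * x), sq_nonneg ‖x‖]

theorem norm_smoothStep_iterate_le {x : ℂ} (hx : ‖x‖ ≤ 1 / 4) (k : ℕ) :
    ‖smoothStep^[k] x‖ ≤ (7 / 8) ^ k := by
  have h : ‖smoothStep^[k] x‖ ≤ (7 / 8) ^ k * ‖x‖ ∧ ‖smoothStep^[k] x‖ ≤ 1 / 4 := by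
    induction k with
    | zero => simpa using hx
    | succ k ih =>
      rw [Function.iterate_succ_apply']
      have := norm_smoothStep_le ih.2
      refine ⟨this.trans ?_, by linarith [norm_nonneg (smoothStep^[k] x)]⟩
      rw [pow_succ]
      linarith [ih.1]
  exact h.1.trans (mul_le_of_le_one_right (by positivity) (by linarith))

theorem differentiable_smoothStep_iterate (k : ℕ) : Differentiable ℂ smoothStep^[k] :=
  Differentiable.iterate (by unfold smoothStep; fun_prop) k

/-- An entire function that is nearly `0` on a disc around `0` and nearly `1` on a disc
around `-b`. -/
theorem exists_switch {b ε : ℝ} (hb : 0 < b) (hε : 0 < ε) :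
    ∃ χ : ℂ → ℂ, Differentiable ℂ χ ∧ (∀ ζ, ‖ζ‖ ≤ b / 4 → ‖χ ζ‖ ≤ ε) ∧
      ∀ ζ : ℂ, ‖ζ + b‖ ≤ b / 4 → ‖1 - χ ζ‖ ≤ ε := by
  obtain ⟨k, hk⟩ := exists_pow_lt_of_lt_one hε (show (7 / 8 : ℝ) < 1 by norm_num)
  have hbc : (b : ℂ) ≠ 0 := by exact_mod_cast hb.ne'
  have hnb : ‖(b : ℂ)‖ = b := by simp [hb.le]
  refine ⟨fun ζ => smoothStep^[k] (-ζ / b),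
    (differentiable_smoothStep_iterate k).comp (by fun_prop), fun ζ hζ => ?_, fun ζ hζ => ?_⟩
  · refine (norm_smoothStep_iterate_le ?_ k).trans hk.le
    rw [norm_div, norm_neg, hnb, div_le_iff₀ hb]
    linarith
  · rw [← smoothStep_iterate_one_sub]
    refine (norm_smoothStep_iterate_le ?_ k).trans hk.le
    have : 1 - -ζ / b = (ζ + b) / b := by field_simp; ring
    rw [this, norm_div, hnb, div_le_iff₀ hb]
    linarith

end Switch

section Universal

variable {E : Type*} [NormedAddCommGroup E] [NormedSpace ℂ E] [ProperSpace E]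

/-- One step of Birkhoff's construction: change `g` into an entire function close to `t` on
a region around `-b`, measured by the functional `l`, while nearly keeping it around `0`. -/
theorem exists_entire_close_to_two (l : E →L[ℂ] ℂ) {b ε : ℝ} (C : ℝ) (hb : 0 < b) (hε : 0 < ε)
    {g t : E → ℂ} (hg : Differentiable ℂ g) (ht : Differentiable ℂ t) :
    ∃ g' : E → ℂ, Differentiable ℂ g' ∧
      (∀ y, ‖y‖ ≤ C → ‖l y‖ ≤ b / 4 → ‖g' y - g y‖ ≤ ε) ∧
      ∀ y, ‖y‖ ≤ C → ‖l y + b‖ ≤ b / 4 → ‖g' y - t y‖ ≤ ε := by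
  have hcont : Continuous fun y => t y - g y := ht.continuous.sub hg.continuous
  obtain ⟨M, hM⟩ := (isCompact_closedBall (0 : E) C).exists_bound_of_continuousOn
    hcont.continuousOn
  have hM' : ∀ y : E, ‖y‖ ≤ C → ‖t y - g y‖ ≤ |M| + 1 := fun y hy =>
    (hM y (by simpa using hy)).trans (by linarith [le_abs_self M])
  have hM0 : 0 < |M| + 1 := by positivity
  obtain ⟨χ, hχ, h0, h1⟩ := exists_switch hb (div_pos hε hM0)
  refine ⟨fun y => g y + χ (l y) * (t y - g y),
    hg.add ((hχ.comp l.differentiable).mul (ht.sub hg)), fun y hy hl => ?_, fun y hy hl => ?_⟩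
  · rw [add_sub_cancel_left, norm_mul]
    calc _ ≤ ε / (|M| + 1) * (|M| + 1) :=
          mul_le_mul (h0 _ hl) (hM' y hy) (norm_nonneg _) (by positivity)
      _ = ε := by field_simp
  · have : g y + χ (l y) * (t y - g y) - t y = -((1 - χ (l y)) * (t y - g y)) := by ring
    rw [this, norm_neg, norm_mul]
    calc _ ≤ ε / (|M| + 1) * (|M| + 1) :=
          mul_le_mul (h1 _ hl) (hM' y hy) (norm_nonneg _) (by positivity)
      _ = ε := by field_simp

/-- Simultaneous approximation on translates: along a fast growing sequence `b j`, an entire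
function can be prescribed up to small errors on the balls of radius `R j` around `-b j • v`. The
sequence `b` does not depend on the prescribed functions `t j`. -/
theorem exists_entire_approx_translates (l : E →L[ℂ] ℂ) {v : E} (hv : l v = 1) {b R : ℕ → ℝ}
    (hb0 : ∀ j, 1 ≤ b j) (hb : ∀ j, 5 * b j ≤ b (j + 1)) (hR : ∀ j, R j ≤ b j)
    (hlR : ∀ j y, ‖y‖ ≤ R j → ‖l y‖ ≤ b j / 4) (t : ℕ → E → ℂ)
    (ht : ∀ j, Differentiable ℂ (t j)) :
    ∃ g : E → ℂ, Differentiable ℂ g ∧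
      ∀ j y, ‖y‖ ≤ R j → ‖g (y - (b j : ℂ) • v) - t j y‖ ≤ 2 * (1 / 2) ^ j := by
  have hbpos : ∀ j, 0 < b j := fun j => zero_lt_one.trans_le (hb0 j)
  have hmono : Monotone b := monotone_nat_of_le_succ fun j => by linarith [hb j, hbpos j]
  set C : ℝ := 1 + ‖v‖ with hC
  have hCpos : 0 < C := by positivity
  have step := fun (j : ℕ) (g : {g : E → ℂ // Differentiable ℂ g}) =>
    exists_entire_close_to_two l (C * b j) (hbpos j) (show (0 : ℝ) < (1 / 2) ^ j by positivity)
      g.2 (show Differentiable ℂ fun y => t j (y + (b j : ℂ) • v) from (ht j).comp (by fun_prop))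
  choose G' hG' h0 h1 using step
  obtain ⟨G, hG₀, hG⟩ : ∃ G : ℕ → {g : E → ℂ // Differentiable ℂ g},
      (G 0).1 = (fun _ => 0) ∧ ∀ j, (G (j + 1)).1 = G' j (G j) :=
    ⟨fun j => Nat.rec ⟨fun _ => 0, differentiable_const 0⟩ (fun j g => ⟨G' j g, hG' j g⟩) j,
      rfl, fun j => rfl⟩
  obtain ⟨d, hd⟩ : ∃ d : ℕ → E → ℂ, ∀ j y, d j y = (G (j + 1)).1 y - (G j).1 y :=
    ⟨_, fun _ _ => rfl⟩
  have hdd : ∀ j, Differentiable ℂ (d j) := fun j => by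
    rw [funext (hd j)]; exact (G (j + 1)).2.sub (G j).2
  -- the regions on which step `j` changes the function by at most `2 ^ (-j)`
  let K : ℕ → Set E := fun j => {y | ‖y‖ ≤ C * b j ∧ ‖l y‖ ≤ b j / 4}
  have hKmono : ∀ {i j}, i ≤ j → K i ⊆ K j := fun {i j} hij y hy =>
    ⟨hy.1.trans (mul_le_mul_of_nonneg_left (hmono hij) hCpos.le),
      hy.2.trans (by linarith [hmono hij])⟩
  have hdK : ∀ j, ∀ y ∈ K j, ‖d j y‖ ≤ (1 / 2) ^ j := fun j y hy => by
    rw [hd, hG]; exact h0 j (G j) y hy.1 hy.2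
  have hbtop : Tendsto b atTop atTop := by
    have : ∀ j : ℕ, (j : ℝ) ≤ b j := fun j => by
      induction j with
      | zero => simpa using (hbpos 0).le
      | succ j ih => push_cast; linarith [hb j, hb0 j]
    exact tendsto_atTop_mono this tendsto_natCast_atTop_atTop
  have hdiff : Differentiable ℂ fun y => ∑' k, d k y := by
    refine differentiable_tsum_of_locally_bounded hdd fun z =>
      ⟨1, one_pos, fun k => (1 / 2) ^ k, summable_geometric_two, ?_⟩
    obtain ⟨k₀, hk₀⟩ := (hbtop.eventually_ge_atTop ((‖z‖ + 1) * 1 + 4 * (‖l‖ * (‖z‖ + 1)))).exists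
    refine ⟨k₀, fun k hk y hy => hdK k y (hKmono hk ⟨?_, ?_⟩)⟩
    all_goals
      have hy' : ‖y‖ ≤ ‖z‖ + 1 := by
        have := norm_le_norm_add_norm_sub' y z
        have h2 := mem_ball_iff_norm.1 hy
        linarith
      have hlz : 0 ≤ ‖l‖ * (‖z‖ + 1) := by positivity
    · calc ‖y‖ ≤ 1 * b k₀ := by linarith
        _ ≤ C * b k₀ := mul_le_mul_of_nonneg_right (by rw [hC]; linarith [norm_nonneg v])
          (hbpos _).le
    · have := (l.le_opNorm y).trans (mul_le_mul_of_nonneg_left hy' (norm_nonneg l))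
      have : 0 ≤ ‖z‖ := norm_nonneg z
      linarith
  have htail : ∀ j, ∀ y ∈ K j, ‖(∑' k, d k y) - (G j).1 y‖ ≤ 2 * (1 / 2) ^ j := fun j y hy => by
    have hbd : ∀ k, ‖d (k + j) y‖ ≤ (1 / 2) ^ j * (1 / 2) ^ k := fun k => by
      rw [← pow_add, add_comm j k]
      exact hdK _ y (hKmono (by omega) hy)
    have hgeo : HasSum (fun k : ℕ => (1 / 2 : ℝ) ^ j * (1 / 2) ^ k) ((1 / 2) ^ j * 2) :=
      hasSum_geometric_two.mul_left _
    have hs : Summable fun k => d (k + j) y := Summable.of_norm_bounded hgeo.summable hbd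
    have h2 := ((summable_nat_add_iff (f := fun k => d k y) j).1 hs).sum_add_tsum_nat_add j
    have h3 : ∑ k ∈ Finset.range j, d k y = (G j).1 y := by
      simp only [hd, Finset.sum_range_sub (fun k => (G k).1 y)]
      rw [hG₀, sub_zero]
    rw [← h2, h3, add_sub_cancel_left, mul_comm (2 : ℝ)]
    exact tsum_of_norm_bounded hgeo hbd
  refine ⟨_, hdiff, fun j y hy => ?_⟩
  have hn : ‖y - (b j : ℂ) • v‖ ≤ C * b j := by
    refine (norm_sub_le _ _).trans ?_
    rw [norm_smul, Complex.norm_real, Real.norm_of_nonneg (hbpos j).le]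
    linarith [hR j]
  have hl : l (y - (b j : ℂ) • v) + b j = l y := by simp [hv]
  have h4 := h1 j (G j) (y - (b j : ℂ) • v) hn (by rw [hl]; exact hlR j y hy)
  rw [← hG, sub_add_cancel] at h4
  have h5 := htail (j + 1) (y - (b j : ℂ) • v) ⟨hn.trans
    (mul_le_mul_of_nonneg_left (hmono (Nat.le_succ j)) hCpos.le), by
      rw [← eq_sub_iff_add_eq] at hl
      rw [hl]
      refine (norm_sub_le _ _).trans ?_
      rw [Complex.norm_real, Real.norm_of_nonneg (hbpos j).le]
      linarith [hlR j y hy, hb j]⟩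
  calc _ ≤ ‖(∑' k, d k (y - (b j : ℂ) • v)) - (G (j + 1)).1 (y - (b j : ℂ) • v)‖ +
        ‖(G (j + 1)).1 (y - (b j : ℂ) • v) - t j y‖ := norm_sub_le_norm_sub_add_norm_sub _ _ _
    _ ≤ 2 * (1 / 2) ^ (j + 1) + (1 / 2) ^ j := add_le_add h5 h4
    _ = 2 * (1 / 2) ^ j := by rw [pow_succ]; ring

end Universal

/-! ### A Banach space of decaying entire functions -/

/-- The entire function `ζ ↦ exp ζ * ∑ x k * (ζ / 2) ^ k / k!` with bounded coefficient
sequence `x`. The series grows at most like `exp (‖ζ‖ / 2)`, so the function decays along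
real translations to the left. -/
noncomputable def decayingSeries (x : ℕ →ᵇ ℂ) (ζ : ℂ) : ℂ :=
  Complex.exp ζ * ∑' k : ℕ, x k * ((ζ / 2) ^ k / (k.factorial : ℂ))

theorem norm_decayingSeries_term_le (x : ℕ →ᵇ ℂ) (ζ : ℂ) (k : ℕ) :
    ‖x k * ((ζ / 2) ^ k / (k.factorial : ℂ))‖ ≤ ‖x‖ * ((‖ζ‖ / 2) ^ k / k.factorial) := by
  rw [norm_mul, norm_div, norm_pow, norm_div, Complex.norm_natCast, Complex.norm_ofNat]
  gcongr
  exact x.norm_coe_le_norm k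

theorem hasSum_exp_div_factorial (r : ℝ) :
    HasSum (fun k : ℕ => r ^ k / k.factorial) (Real.exp r) := by
  rw [Real.exp_eq_exp_ℝ]
  exact NormedSpace.expSeries_div_hasSum_exp r

theorem norm_decayingSeries_le (x : ℕ →ᵇ ℂ) (ζ : ℂ) :
    ‖decayingSeries x ζ‖ ≤ ‖x‖ * Real.exp (ζ.re + ‖ζ‖ / 2) := by
  rw [decayingSeries, norm_mul, Complex.norm_exp, Real.exp_add, mul_left_comm]
  gcongr
  exact tsum_of_norm_bounded ((hasSum_exp_div_factorial (‖ζ‖ / 2)).mul_left ‖x‖)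
    (norm_decayingSeries_term_le x ζ)

/-- Joint holomorphy in the coefficients and the variable. -/
theorem differentiable_decayingSeries :
    Differentiable ℂ fun p : (ℕ →ᵇ ℂ) × ℂ => decayingSeries p.1 p.2 := by
  unfold decayingSeries
  refine differentiable_snd.cexp.mul ?_
  refine differentiable_tsum_of_locally_bounded
    (f := fun k (p : (ℕ →ᵇ ℂ) × ℂ) => p.1 k * ((p.2 / 2) ^ k / (k.factorial : ℂ)))
    (fun k => ?_) fun p => ⟨1, one_pos,
      fun k => (‖p‖ + 1) * (((‖p‖ + 1) / 2) ^ k / k.factorial),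
      (hasSum_exp_div_factorial _).summable.mul_left _, 0, fun k _ q hq => ?_⟩
  · have h : Differentiable ℂ fun p : (ℕ →ᵇ ℂ) × ℂ => p.1 k :=
      ((BoundedContinuousFunction.evalCLM (α := ℕ) (β := ℂ) ℂ k).comp
        (ContinuousLinearMap.fst ℂ (ℕ →ᵇ ℂ) ℂ)).differentiable
    exact h.mul (by fun_prop)
  · have h : ‖q‖ ≤ ‖p‖ + 1 := by
      have := norm_le_norm_add_norm_sub' q p
      have h2 := mem_ball_iff_norm.1 hq
      linarith
    refine (norm_decayingSeries_term_le q.1 q.2 k).trans ?_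
    have h1 := (norm_fst_le q).trans h
    have h2 := (norm_snd_le q).trans h
    exact mul_le_mul h1 (by gcongr) (by positivity) (by positivity)

/-- The functions `decayingSeries x` tend to zero along real translations to the left. -/
theorem norm_decayingSeries_sub_le (x : ℕ →ᵇ ℂ) {ζ : ℂ} {b : ℝ} (hb : 0 ≤ b) :
    ‖decayingSeries x (ζ - b)‖ ≤ ‖x‖ * Real.exp (2 * ‖ζ‖ - b / 2) := by
  refine (norm_decayingSeries_le x _).trans ?_
  gcongr
  have h1 : ‖ζ - b‖ ≤ ‖ζ‖ + b := by
    refine (norm_sub_le _ _).trans ?_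
    rw [Complex.norm_real, Real.norm_of_nonneg hb]
  have h2 : ζ.re ≤ ‖ζ‖ := Complex.re_le_norm ζ
  simp only [Complex.sub_re, Complex.ofReal_re]
  linarith [norm_nonneg ζ]

/-- Lagrange interpolation by functions `decayingSeries x`. -/
theorem exists_decayingSeries_eqOn (s : Finset ℂ) (c : ℂ → ℂ) :
    ∃ x : ℕ →ᵇ ℂ, ∀ ζ ∈ s, decayingSeries x ζ = c ζ := by
  set p : Polynomial ℂ := Lagrange.interpolate s id fun ζ => Complex.exp (-ζ) * c ζ with hp
  set a : ℕ → ℂ := fun k => p.coeff k * (2 ^ k * (k.factorial : ℂ)) with ha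
  have ha0 : ∀ k ∉ Finset.range (p.natDegree + 1), a k = 0 := fun k hk => by
    rw [ha]
    simp only [Polynomial.coeff_eq_zero_of_natDegree_lt
      (show p.natDegree < k by simpa [Nat.lt_succ_iff] using hk), zero_mul]
  have hbd : ∃ C, ∀ k, ‖a k‖ ≤ C := by
    refine ⟨∑ i ∈ Finset.range (p.natDegree + 1), ‖a i‖, fun k => ?_⟩
    by_cases hk : k ∈ Finset.range (p.natDegree + 1)
    · exact Finset.single_le_sum (f := fun i => ‖a i‖) (fun i _ => norm_nonneg _) hk
    · rw [ha0 k hk, norm_zero]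
      exact Finset.sum_nonneg fun i _ => norm_nonneg _
  obtain ⟨C, hC⟩ := hbd
  refine ⟨BoundedContinuousFunction.ofNormedAddCommGroupDiscrete a C hC, fun ζ hζ => ?_⟩
  have hsum : ∑' k : ℕ, a k * ((ζ / 2) ^ k / (k.factorial : ℂ)) = p.eval ζ := by
    rw [tsum_eq_sum (s := Finset.range (p.natDegree + 1)) (fun k hk => by rw [ha0 k hk, zero_mul]),
      Polynomial.eval_eq_sum_range]
    refine Finset.sum_congr rfl fun k _ => ?_
    have : (k.factorial : ℂ) ≠ 0 := by exact_mod_cast k.factorial_ne_zero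
    rw [ha, div_pow]
    field_simp
  have heval : p.eval ζ = Complex.exp (-ζ) * c ζ :=
    Lagrange.eval_interpolate_at_node (v := id) _ (Set.injOn_id _) hζ
  rw [decayingSeries]
  simp only [BoundedContinuousFunction.coe_ofNormedAddCommGroupDiscrete]
  rw [hsum, heval, ← mul_assoc, ← Complex.exp_add, add_neg_cancel, Complex.exp_zero, one_mul]

/-! ### Generic orbits of reduced words -/

section Words

/-- The data describing how two generators and their inverses move a point of a vector space, up
to two function parameters `p γ : ℂ → ℂ`. The letter `(0, ±)` is a translation by `±w`
conjugated by the shear `z ↦ z + p (μ z) • u`; the letter `(1, ±)` is a fixed map `A ±`, followed by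
a displacement in the direction `v ±` that is proportional to the value of `γ` at `ν ± z`. The
remaining fields say that each displacement is seen by the functionals evaluated next. -/
structure WordModel (V : Type*) [AddCommGroup V] [Module ℂ V] where
  /-- the functional on which the conjugating shear depends -/
  μ : V →ₗ[ℂ] ℂ
  /-- the translation vector -/
  w : V
  /-- the direction of the conjugating shear -/
  u : V
  /-- the functionals on which the second generator and its inverse depend -/
  ν : Bool → V →ₗ[ℂ] ℂ
  /-- the directions in which the second generator and its inverse displace -/
  v : Bool → V
  /-- the unperturbed second generator and its inverse -/
  A : Bool → V → V
  /-- the scaling of the displacement -/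
  κ : Bool → V → ℂ
  μ_u : μ u = 0
  μ_w : μ w ≠ 0
  μ_v : ∀ δ, μ (v δ) ≠ 0
  ν_u : ∀ δ, ν δ u ≠ 0
  ν_v : ∀ δ, ν δ (v δ) ≠ 0
  κ_ne : ∀ δ z, κ δ z ≠ 0

namespace WordModel

variable {V : Type*} [AddCommGroup V] [Module ℂ V] (M : WordModel V)

/-- The sign of a letter: `1` for a generator and `-1` for its inverse. -/
def sgn (δ : Bool) : ℂ := if δ then 1 else -1

theorem sgn_ne_zero (δ : Bool) : sgn δ ≠ 0 := by cases δ <;> simp [sgn]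

/-- The action of a letter. -/
def step (p γ : ℂ → ℂ) : Fin 2 × Bool → V → V
  | (0, δ), z => z + sgn δ • M.w + (p (M.μ z + sgn δ * M.μ M.w) - p (M.μ z)) • M.u
  | (1, δ), z => M.A δ z + (M.κ δ z * γ (M.ν δ z)) • M.v δ

/-- The action of a word, the last letter of the list acting first. -/
def eval (p γ : ℂ → ℂ) (L : List (Fin 2 × Bool)) (z : V) : V :=
  L.foldr (M.step p γ) z

/-- The direction in which the displacement by a letter can be adjusted freely. -/
def dir : Fin 2 × Bool → V
  | (0, _) => M.u
  | (1, δ) => M.v δ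

/-- The letter `a`, applied at `z`, reads `p` and `γ` at points where they have not been read
before, `S` and `T` being the sets of earlier points. For the first generator all the points that
its further powers would read are included. -/
def Fresh (S T : Finset ℂ) : Fin 2 × Bool → V → Prop
  | (0, δ), z => ∀ k : ℕ, M.μ z + (k + 1) * (sgn δ * M.μ M.w) ∉ S
  | (1, δ), z => M.ν δ z ∉ T

/-- At every point, a letter reads its function parameters at finitely many points only. -/
theorem exists_finset_step_congr (p γ : ℂ → ℂ) (a : Fin 2 × Bool) (z : V) :
    ∃ S T : Finset ℂ, ∀ p' γ' : ℂ → ℂ, (∀ r ∈ S, p' r = p r) → (∀ q ∈ T, γ' q = γ q) →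
      M.step p' γ' a z = M.step p γ a z := by
  obtain ⟨i, δ⟩ := a
  fin_cases i
  · refine ⟨{M.μ z, M.μ z + sgn δ * M.μ M.w}, ∅, fun p' γ' hp _ => ?_⟩
    simp [step, hp (M.μ z) (by simp), hp (M.μ z + sgn δ * M.μ M.w) (by simp)]
  · refine ⟨∅, {M.ν δ z}, fun p' γ' _ hγ => ?_⟩
    simp [step, hγ (M.ν δ z) (by simp)]

theorem exists_finset_eval_congr (p γ : ℂ → ℂ) (L : List (Fin 2 × Bool)) (z : V) :
    ∃ S T : Finset ℂ, ∀ p' γ' : ℂ → ℂ, (∀ r ∈ S, p' r = p r) → (∀ q ∈ T, γ' q = γ q) →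
      M.eval p' γ' L z = M.eval p γ L z := by
  classical
  induction L with
  | nil => exact ⟨∅, ∅, fun _ _ _ _ => rfl⟩
  | cons a L ih =>
    obtain ⟨S, T, h⟩ := ih
    obtain ⟨S', T', h'⟩ := M.exists_finset_step_congr p γ a (M.eval p γ L z)
    refine ⟨S ∪ S', T ∪ T', fun p' γ' hp hγ => ?_⟩
    have h1 := h p' γ' (fun r hr => hp r (Finset.mem_union_left _ hr))
      fun q hq => hγ q (Finset.mem_union_left _ hq)
    simp only [eval, List.foldr_cons] at h1 h' ⊢
    rw [h1]
    exact h' p' γ' (fun r hr => hp r (Finset.mem_union_right _ hr))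
      fun q hq => hγ q (Finset.mem_union_right _ hq)

/-- Some orbit of the word `L` ends at a point that is fresh for the letter `a`. -/
def Reaches (L : List (Fin 2 × Bool)) (a : Fin 2 × Bool) : Prop :=
  ∃ (z₀ z : V) (S T : Finset ℂ) (p γ : ℂ → ℂ),
    (∀ p' γ' : ℂ → ℂ, (∀ r ∈ S, p' r = p r) → (∀ q ∈ T, γ' q = γ q) → M.eval p' γ' L z₀ = z) ∧
    M.Fresh S T a z

/-- For suitable function parameters, the word `a :: L` moves some point to an arbitrary point of a
line in the direction `dir a`, leaving room for further letters `a`. -/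
def Sweeps (L : List (Fin 2 × Bool)) (a : Fin 2 × Bool) : Prop :=
  ∃ (z₀ y : V) (S T : Finset ℂ), (∀ s : ℂ, ∃ p γ : ℂ → ℂ, ∀ p' γ' : ℂ → ℂ,
      (∀ r ∈ S, p' r = p r) → (∀ q ∈ T, γ' q = γ q) →
        M.eval p' γ' (a :: L) z₀ = y + s • M.dir a) ∧
    (a.1 = 0 → M.Fresh S T a y)

theorem Reaches.sweeps {L : List (Fin 2 × Bool)} {a : Fin 2 × Bool} (h : M.Reaches L a) :
    M.Sweeps L a := by
  classical
  obtain ⟨z₀, z, S, T, p, γ, hz, hf⟩ := h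
  obtain ⟨i, δ⟩ := a
  fin_cases i
  · set c : ℂ := sgn δ * M.μ M.w with hc
    have hc0 : c ≠ 0 := mul_ne_zero (sgn_ne_zero δ) M.μ_w
    have hne : M.μ z ≠ M.μ z + c := by simpa using hc0
    refine ⟨z₀, z + sgn δ • M.w - p (M.μ z) • M.u, insert (M.μ z) (insert (M.μ z + c) S), T,
      fun s => ⟨Function.update p (M.μ z + c) s, γ, fun p' γ' hp hγ => ?_⟩, fun _ k => ?_⟩
    · have h1 : p' (M.μ z) = p (M.μ z) := by
        rw [hp _ (by simp), Function.update_of_ne hne]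
      have h2 : p' (M.μ z + c) = s := by
        rw [hp _ (by simp), Function.update_self]
      have h3 : M.eval p' γ' L z₀ = z := hz p' γ' (fun r hr => by
        rw [hp r (by simp [hr]), Function.update_of_ne]
        rintro rfl
        exact hf 0 (by simpa [hc] using hr)) hγ
      simp only [eval, List.foldr_cons] at h3 ⊢
      rw [h3]
      simp only [step, ← hc, h1, h2, dir]
      module
    · have h4 : M.μ (z + sgn δ • M.w - p (M.μ z) • M.u) = M.μ z + c := by
        simp [M.μ_u, hc]
      have h5 : M.μ z + c + ((k : ℂ) + 1) * c = M.μ z + (((k + 1 : ℕ) : ℂ) + 1) * c := by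
        push_cast; ring
      simp only [h4, ← hc, h5, Finset.mem_insert, not_or]
      refine ⟨?_, ?_, hf (k + 1)⟩
      · have h6 : ((k + 1 : ℕ) : ℂ) + 1 ≠ 0 := Nat.cast_add_one_ne_zero (k + 1)
        simpa only [add_eq_left, mul_eq_zero, not_or] using ⟨h6, hc0⟩
      · intro h
        have h6 := mul_right_cancel₀ hc0 ((add_left_cancel h).trans (one_mul c).symm)
        have h7 : ((k + 1 : ℕ) : ℂ) = 0 := by linear_combination h6
        exact Nat.cast_ne_zero.2 (Nat.succ_ne_zero k) h7
  · refine ⟨z₀, M.A δ z, S, insert (M.ν δ z) T,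
      fun s => ⟨p, Function.update γ (M.ν δ z) ((M.κ δ z)⁻¹ * s), fun p' γ' hp hγ => ?_⟩,
      fun h => absurd h (by simp)⟩
    have h2 : γ' (M.ν δ z) = (M.κ δ z)⁻¹ * s := by
      rw [hγ _ (by simp), Function.update_self]
    have h3 : M.eval p' γ' L z₀ = z := hz p' γ' hp (fun q hq => by
      rw [hγ q (by simp [hq]), Function.update_of_ne]
      rintro rfl
      exact hf hq)
    simp only [eval, List.foldr_cons] at h3 ⊢
    rw [h3]
    simp only [step, h2, dir, mul_inv_cancel_left₀ (M.κ_ne δ z)]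

theorem exists_add_mul_notMem_of_countable {C : Set ℂ} (hC : C.Countable) (a : ℂ) {b : ℂ}
    (hb : b ≠ 0) : ∃ s : ℂ, a + s * b ∉ C := by
  have h : ((fun s : ℂ => a + s * b) ⁻¹' C).Countable :=
    hC.preimage fun s t hst => mul_right_cancel₀ hb (add_left_cancel hst)
  by_contra! hall
  exact not_countable_complex (h.mono fun s _ => hall s)

theorem Sweeps.reaches {L : List (Fin 2 × Bool)} {a b : Fin 2 × Bool} (h : M.Sweeps L b)
    (hab : a.1 = b.1 → a.2 = b.2) : M.Reaches (b :: L) a := by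
  obtain ⟨z₀, y, S, T, hz, hf⟩ := h
  suffices hs : ∃ s : ℂ, M.Fresh S T a (y + s • M.dir b) by
    obtain ⟨s, hs⟩ := hs
    obtain ⟨p, γ, h⟩ := hz s
    exact ⟨z₀, _, S, T, p, γ, h, hs⟩
  obtain ⟨i, δ⟩ := a
  obtain ⟨j, δ'⟩ := b
  -- the direction of the last displacement is seen by the functional of the next letter
  have hT : i = 1 → ∃ s : ℂ, M.Fresh S T (i, δ) (y + s • M.dir (j, δ')) := by
    rintro rfl
    have hne : M.ν δ (M.dir (j, δ')) ≠ 0 := by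
      fin_cases j
      · exact M.ν_u δ
      · obtain rfl : δ = δ' := hab rfl
        exact M.ν_v δ
    obtain ⟨s, hs⟩ := exists_add_mul_notMem_of_countable T.countable_toSet (M.ν δ y) hne
    exact ⟨s, by simpa [Fresh] using hs⟩
  by_cases hi : i = 1
  · exact hT hi
  obtain rfl : i = 0 := by omega
  by_cases hj : j = 0
  · subst hj
    obtain rfl : δ = δ' := hab rfl
    exact ⟨0, by simpa using hf rfl⟩
  obtain rfl : j = 1 := by omega
  have hC : (⋃ k : ℕ, (fun r : ℂ => r - (k + 1) * (sgn δ * M.μ M.w)) '' (S : Set ℂ)).Countable :=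
    Set.countable_iUnion fun k => S.countable_toSet.image _
  obtain ⟨s, hs⟩ := exists_add_mul_notMem_of_countable hC (M.μ y) (M.μ_v δ')
  refine ⟨s, fun k hk => hs (Set.mem_iUnion.2 ⟨k, _, hk, ?_⟩)⟩
  simp [dir]

theorem sweeps_of_isReduced (L : List (Fin 2 × Bool)) (a : Fin 2 × Bool)
    (h : FreeGroup.IsReduced (a :: L)) : M.Sweeps L a := by
  induction L generalizing a with
  | nil =>
    refine Reaches.sweeps M ⟨0, 0, ∅, ∅, 0, 0, fun _ _ _ _ => rfl, ?_⟩
    obtain ⟨i, δ⟩ := a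
    fin_cases i <;> simp [Fresh]
  | cons b L ih =>
    rw [FreeGroup.isReduced_cons_cons] at h
    exact ((ih b h.2).reaches M h.1).sweeps M

/-- A nonempty reduced word acts nontrivially for suitable function parameters. -/
theorem exists_eval_ne {L : List (Fin 2 × Bool)} (hL : FreeGroup.IsReduced L) (hne : L ≠ []) :
    ∃ (p γ : ℂ → ℂ) (z : V), M.eval p γ L z ≠ z := by
  obtain _ | ⟨a, L⟩ := L
  · exact absurd rfl hne
  obtain ⟨z₀, y, S, T, hz, -⟩ := M.sweeps_of_isReduced L a hL
  have hd : M.dir a ≠ 0 := by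
    obtain ⟨i, δ⟩ := a
    fin_cases i
    · exact fun h => M.ν_u true (by simp only [dir] at h; rw [h, map_zero])
    · exact fun h => M.ν_v δ (by simp only [dir] at h; rw [h, map_zero])
  obtain ⟨p, γ, h0⟩ := hz 0
  obtain ⟨p', γ', h1⟩ := hz 1
  by_cases h : M.eval p γ (a :: L) z₀ = z₀
  · refine ⟨p', γ', z₀, fun h' => hd ?_⟩
    rw [h0 p γ (fun _ _ => rfl) fun _ _ => rfl] at h
    rw [h1 p' γ' (fun _ _ => rfl) fun _ _ => rfl] at h'
    simpa using h'.trans h.symm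
  · exact ⟨p, γ, z₀, h⟩

end WordModel

end Words

/-! ### Automorphisms as maps -/

namespace HolAut

variable {N n : ℕ}

theorem ext {F G : HolAut N} (h : ∀ z, F.1 z = G.1 z) : F = G :=
  Subtype.ext (Homeomorph.ext h)

theorem mul_apply (F G : HolAut N) (z : CSpace N) : (F * G).1 z = F.1 (G.1 z) := rfl

theorem one_apply (z : CSpace N) : (1 : HolAut N).1 z = z := rfl

theorem inv_apply_self (F : HolAut N) (z : CSpace N) : (F⁻¹).1 (F.1 z) = z :=
  F.1.symm_apply_apply z

theorem apply_inv_self (F : HolAut N) (z : CSpace N) : F.1 ((F⁻¹).1 z) = z :=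
  F.1.apply_symm_apply z

theorem translation_apply (w z : CSpace N) : (translation w).1 z = z + w := rfl

theorem translation_inv (w : CSpace N) : (translation w)⁻¹ = translation (-w) :=
  ext fun z => sub_eq_add_neg z w

theorem translation_pow (w : CSpace N) (k : ℕ) : translation w ^ k = translation ((k : ℂ) • w) := by
  induction k with
  | zero => exact ext fun z => by simp [translation_apply]
  | succ k ih =>
    rw [pow_succ, ih]
    refine ext fun z => ?_
    rw [mul_apply, translation_apply, translation_apply, translation_apply]
    push_cast
    module

theorem linear_apply (A : Matrix.SpecialLinearGroup (Fin N) ℂ) (z : CSpace N) :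
    (linear A).1 z = A.1.mulVec z := rfl

theorem linear_mul (A B : Matrix.SpecialLinearGroup (Fin N) ℂ) :
    linear (A * B) = linear A * linear B :=
  ext fun z => by
    rw [mul_apply, linear_apply, linear_apply, linear_apply, Matrix.mulVec_mulVec,
      Matrix.SpecialLinearGroup.coe_mul]

theorem linear_one : linear (1 : Matrix.SpecialLinearGroup (Fin N) ℂ) = 1 :=
  ext fun z => by rw [linear_apply, one_apply]; simp

theorem linear_inv (A : Matrix.SpecialLinearGroup (Fin N) ℂ) :
    (linear A)⁻¹ = linear A⁻¹ :=
  inv_eq_of_mul_eq_one_left (by rw [← linear_mul, inv_mul_cancel, linear_one])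

/-- A translation conjugated by a linear automorphism. -/
theorem linear_conj_translation (A : Matrix.SpecialLinearGroup (Fin N) ℂ) {v w : CSpace N}
    (h : A.1.mulVec w = v) : (linear A)⁻¹ * translation v * linear A = translation w := by
  refine mul_left_cancel (a := linear A) (ext fun z => ?_)
  simp only [mul_apply, apply_inv_self, translation_apply, linear_apply, Matrix.mulVec_add, h]

theorem axisOvershear_apply {f g : CSpace n → ℂ} (hf : Differentiable ℂ f)
    (hg : Differentiable ℂ g) (z : CSpace (n + 1)) :
    (axisOvershear f g hf hg).1 z =
      Fin.snoc (Fin.init z) (Complex.exp (f (Fin.init z)) * z (Fin.last n) + g (Fin.init z)) := rfl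

theorem axisOvershear_inv_apply {f g : CSpace n → ℂ} (hf : Differentiable ℂ f)
    (hg : Differentiable ℂ g) (z : CSpace (n + 1)) :
    ((axisOvershear f g hf hg)⁻¹).1 z =
      Fin.snoc (Fin.init z)
        (Complex.exp (-f (Fin.init z)) * (z (Fin.last n) - g (Fin.init z))) := rfl

theorem axisShear_apply {g : CSpace n → ℂ} (hg : Differentiable ℂ g) (z : CSpace (n + 1)) :
    (axisShear g hg).1 z = z + g (Fin.init z) • Pi.single (Fin.last n) 1 := by
  rw [axisShear, axisOvershear_apply]
  funext i
  refine Fin.lastCases ?_ (fun j => ?_) i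
  · simp
  · simp [Fin.init]

theorem axisOvershear_one : axisOvershear (n := n) (fun _ => 0) (fun _ => 0)
    (differentiable_const 0) (differentiable_const 0) = 1 :=
  ext fun z => by simp [axisOvershear_apply]

theorem twist_apply (z : CSpace (n + 1)) :
    (twist n).1 z = Fin.snoc (Fin.tail z) (-(-1 : ℂ) ^ (n + 1) * z 0) := rfl

theorem twist_inv_apply (z : CSpace (n + 1)) :
    ((twist n)⁻¹).1 z = Fin.cons (-(-1 : ℂ) ^ (n + 1) * z (Fin.last n)) (Fin.init z) := rfl

/-! ### Linear automorphisms in groups of overshears -/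

/-- The matrix of the linear map `twist`. -/
noncomputable def twistMatrix (n : ℕ) : Matrix (Fin (n + 1)) (Fin (n + 1)) ℂ :=
  Matrix.of fun i => Fin.snoc (α := fun _ => Fin (n + 1) → ℂ)
    (fun k : Fin n => Pi.single k.succ 1) (Pi.single 0 (-(-1 : ℂ) ^ (n + 1))) i

theorem twistMatrix_castSucc (k : Fin n) : twistMatrix n k.castSucc = Pi.single k.succ 1 := by
  funext j
  rw [twistMatrix, Matrix.of_apply, Fin.snoc_castSucc]

theorem twistMatrix_last : twistMatrix n (Fin.last n) = Pi.single 0 (-(-1 : ℂ) ^ (n + 1)) := by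
  funext j
  rw [twistMatrix, Matrix.of_apply, Fin.snoc_last]

theorem det_twistMatrix (n : ℕ) : (twistMatrix n).det = 1 := by
  rw [Matrix.det_succ_column_zero, Fin.sum_univ_castSucc, Finset.sum_eq_zero, zero_add]
  · have h : (twistMatrix n).submatrix (Fin.last n).succAbove Fin.succ = 1 := by
      ext i j
      rw [Matrix.submatrix_apply, Fin.succAbove_last, twistMatrix_castSucc]
      simp [Matrix.one_apply, Pi.single_apply, eq_comm]
    rw [h, twistMatrix_last, Matrix.det_one, Pi.single_eq_same, Fin.val_last, mul_one, pow_succ,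
      mul_neg_one, neg_neg, ← mul_pow]
    simp
  · intro k _
    rw [twistMatrix_castSucc]
    simp

/-- The linear map `twist` as an element of the special linear group. -/
noncomputable def twistSL (n : ℕ) : Matrix.SpecialLinearGroup (Fin (n + 1)) ℂ :=
  ⟨twistMatrix n, det_twistMatrix n⟩

theorem linear_twistSL (n : ℕ) : linear (twistSL n) = twist n := by
  refine ext fun z => ?_
  rw [linear_apply, twist_apply]
  change (twistMatrix n).mulVec z = _
  funext i
  refine Fin.lastCases ?_ (fun j => ?_) i
  · simp [Matrix.mulVec, twistMatrix_last]
  · simp [Matrix.mulVec, twistMatrix_castSucc, Fin.tail]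

theorem twist_add (z y : CSpace (n + 1)) : (twist n).1 (z + y) = (twist n).1 z + (twist n).1 y := by
  rw [← linear_twistSL]; exact Matrix.mulVec_add _ z y

theorem twist_smul (c : ℂ) (z : CSpace (n + 1)) : (twist n).1 (c • z) = c • (twist n).1 z := by
  rw [← linear_twistSL]; exact Matrix.mulVec_smul _ c z

theorem twist_single_succ (i : Fin n) :
    (twist n).1 (Pi.single i.succ 1) = Pi.single i.castSucc 1 := by
  rw [twist_apply]
  funext k
  refine Fin.lastCases ?_ (fun j => ?_) k
  · simp [(Fin.succ_ne_zero i).symm, (Fin.castSucc_lt_last i).ne']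
  · simp [Fin.tail, Pi.single_apply]

open Matrix.SpecialLinearGroup in
/-- The special linear group is generated by transvections. -/
theorem specialLinearGroup_induction {ι : Type*} [Fintype ι] [DecidableEq ι] [Nontrivial ι]
    (P : Matrix.SpecialLinearGroup ι ℂ → Prop)
    (htransvec : ∀ (i j : ι) (hij : i ≠ j) (a : ℂ), P (transvection hij a))
    (hmul : ∀ A B, P A → P B → P (A * B)) (A : Matrix.SpecialLinearGroup ι ℂ) : P A := by
  refine diagonal_transvection_induction' P A (fun i j hij c hc => ?_) htransvec hmul
  -- the factorisation behind Whitehead's lemma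
  have h : diag2n hij c hc = transvection hij c * transvection hij.symm (-c⁻¹) *
      transvection hij c * transvection hij (-1) * transvection hij.symm 1 *
      transvection hij (-1) := by
    apply Subtype.ext
    simp only [Matrix.SpecialLinearGroup.coe_mul, transvection_coe, diag2n_coe]
    have hsum : Matrix.diagonal (fun k => if k = i then c else if k = j then c⁻¹ else 1) =
        (1 : Matrix ι ι ℂ) + Matrix.single i i (c - 1) + Matrix.single j j (c⁻¹ - 1) := by
      ext a b
      simp only [Matrix.diagonal_apply, Matrix.add_apply, Matrix.one_apply, Matrix.single_apply]
      grind
    rw [hsum]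
    simp only [mul_add, add_mul, one_mul, mul_one, add_zero,
      Matrix.single_mul_single_same,
      Matrix.single_mul_single_of_ne _ _ _ _ hij, Matrix.single_mul_single_of_ne _ _ _ _ hij.symm]
    ext a b
    simp only [Matrix.add_apply, Matrix.one_apply, Matrix.single_apply]
    have := mul_inv_cancel₀ hc
    grind
  rw [h]
  exact hmul _ _ (hmul _ _ (hmul _ _ (hmul _ _ (hmul _ _ (htransvec ..) (htransvec ..))
    (htransvec ..)) (htransvec ..)) (htransvec ..)) (htransvec ..)

theorem linear_mem_of_transvections (hn : 1 ≤ n) {Γ : Subgroup (HolAut (n + 1))}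
    (h : ∀ (i j : Fin (n + 1)) (hij : i ≠ j) (c : ℂ),
      linear (Matrix.SpecialLinearGroup.transvection hij c) ∈ Γ)
    (A : Matrix.SpecialLinearGroup (Fin (n + 1)) ℂ) : linear A ∈ Γ := by
  have : Nontrivial (Fin (n + 1)) := Fin.nontrivial_iff_two_le.2 (by omega)
  refine specialLinearGroup_induction (fun A => linear A ∈ Γ) h (fun A B hA hB => ?_) A
  rw [linear_mul]
  exact Γ.mul_mem hA hB

/-- Conjugation by the twist carries shears in direction of one coordinate axis to shears in
direction of the preceding one. -/
theorem linearShear_mem {Γ : Subgroup (HolAut (n + 1))}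
    (htw : ∀ H, (twist n)⁻¹ * H * twist n ∈ Γ → H ∈ Γ)
    (hax : ∀ (g : CSpace n → ℂ) (hg : Differentiable ℂ g), axisShear g hg ∈ Γ) (i : Fin (n + 1)) :
    ∀ (l : CSpace (n + 1) →ₗ[ℂ] ℂ), l (Pi.single i 1) = 0 → ∀ H : HolAut (n + 1),
      (∀ z, H.1 z = z + l z • Pi.single i 1) → H ∈ Γ := by
  induction i using Fin.reverseInduction with
  | last =>
    intro l hl H hH
    have hg : Differentiable ℂ fun y : CSpace n => l (Fin.snoc y 0) := by
      have h1 : Differentiable ℂ fun y : CSpace n => (Fin.snoc y (0 : ℂ) : CSpace (n + 1)) :=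
        differentiable_snoc differentiable_id (differentiable_const 0)
      exact l.toContinuousLinearMap.differentiable.comp h1
    have : H = axisShear _ hg := ext fun z => by
      have hz : z = Fin.snoc (Fin.init z) 0 + z (Fin.last n) • Pi.single (Fin.last n) 1 := by
        funext k
        refine Fin.lastCases ?_ (fun j => ?_) k <;> simp [Fin.init]
      have h2 : l z = l (Fin.snoc (Fin.init z) 0) := by
        conv_lhs => rw [hz]
        rw [map_add, map_smul, hl, smul_zero, add_zero]
      rw [hH, axisShear_apply, h2]
    exact this ▸ hax _ hg
  | cast i ih =>
    intro l hl H hH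
    let tw : CSpace (n + 1) →ₗ[ℂ] CSpace (n + 1) :=
      { toFun := (twist n).1, map_add' := twist_add, map_smul' := twist_smul }
    refine htw H (ih (l ∘ₗ tw) ?_ _ fun z => ?_)
    · rw [LinearMap.comp_apply, ← hl]
      exact congrArg l (twist_single_succ i)
    · rw [mul_apply, mul_apply, hH, ← twist_single_succ, ← twist_smul, ← twist_add,
        inv_apply_self]
      rfl

theorem transvection_apply {i j : Fin N} (hij : i ≠ j) (c : ℂ) (z : CSpace N) :
    (linear (Matrix.SpecialLinearGroup.transvection hij c)).1 z =
      z + (c * z j) • Pi.single i 1 := by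
  rw [linear_apply, Matrix.SpecialLinearGroup.transvection_coe, Matrix.add_mulVec,
    Matrix.one_mulVec, Matrix.single_mulVec]
  congr 1
  funext k
  simp [Function.update_apply, Pi.single_apply]

/-- A group invariant under conjugation by the twist and containing all shears in direction of the
last axis contains the special linear group. -/
theorem linear_mem_of_axisShear (hn : 1 ≤ n) {Γ : Subgroup (HolAut (n + 1))}
    (htw : ∀ H, (twist n)⁻¹ * H * twist n ∈ Γ → H ∈ Γ)
    (hax : ∀ (g : CSpace n → ℂ) (hg : Differentiable ℂ g), axisShear g hg ∈ Γ)
    (A : Matrix.SpecialLinearGroup (Fin (n + 1)) ℂ) : linear A ∈ Γ := by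
  refine linear_mem_of_transvections hn (fun i j hij c => ?_) A
  refine linearShear_mem htw hax i (c • LinearMap.proj j) (by simp [hij.symm]) _ fun z => ?_
  rw [transvection_apply]
  rfl

/-- The special linear group acts transitively on nonzero vectors. -/
theorem exists_mulVec_eq (hn : 1 ≤ n) {v w : CSpace (n + 1)} (hv : v ≠ 0) (hw : w ≠ 0) :
    ∃ A : Matrix.SpecialLinearGroup (Fin (n + 1)) ℂ, A.1.mulVec v = w := by
  have : Nontrivial (Fin (n + 1)) := Fin.nontrivial_iff_two_le.2 (by omega)
  have hl : Fin.last n ≠ 0 := by simp [Fin.ext_iff]; omega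
  -- transitivity on projective space, corrected by a diagonal matrix
  have key : ∀ w : CSpace (n + 1), w ≠ 0 →
      ∃ A : Matrix.SpecialLinearGroup (Fin (n + 1)) ℂ, A • (Pi.single 0 1 : CSpace (n + 1)) = w := by
    intro w hw
    have he : (Pi.single 0 1 : CSpace (n + 1)) ≠ 0 := by simp
    obtain ⟨g, hg⟩ := MulAction.exists_smul_eq (Matrix.SpecialLinearGroup (Fin (n + 1)) ℂ)
      (Projectivization.mk ℂ _ he) (Projectivization.mk ℂ w hw)
    rw [Projectivization.smul_mk, Projectivization.mk_eq_mk_iff'] at hg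
    obtain ⟨a, ha⟩ := hg
    have ha0 : a ≠ 0 := by
      rintro rfl
      rw [zero_smul] at ha
      exact ((smul_ne_zero_iff_ne g).2 he) ha.symm
    refine ⟨g * Matrix.SpecialLinearGroup.diag2n hl.symm a⁻¹ (inv_ne_zero ha0), ?_⟩
    have hd : Matrix.SpecialLinearGroup.diag2n hl.symm a⁻¹ (inv_ne_zero ha0) •
        (Pi.single 0 1 : CSpace (n + 1)) = a⁻¹ • Pi.single 0 1 := by
      rw [Matrix.SpecialLinearGroup.smul_def, Matrix.SpecialLinearGroup.diag2n_coe]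
      funext k
      rw [Matrix.smul_eq_mulVec, Matrix.mulVec_diagonal]
      by_cases hk : k = 0 <;> simp [hk]
    rw [mul_smul, hd, smul_comm, ← ha, smul_smul, inv_mul_cancel₀ ha0, one_smul]
  obtain ⟨A, hA⟩ := key v hv
  obtain ⟨B, hB⟩ := key w hw
  refine ⟨B * A⁻¹, ?_⟩
  change (B * A⁻¹) • v = w
  rw [mul_smul, ← hA, inv_smul_smul, hB]

end HolAut

/-! ### Closures of groups of automorphisms -/

namespace HolAut

variable {N n : ℕ}

/-- An automorphism together with its inverse, as continuous maps. -/
noncomputable def biMap (F : HolAut N) : C(CSpace N, CSpace N) × C(CSpace N, CSpace N) :=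
  (toContinuousMap F, toContinuousMap F⁻¹)

/-- The composition law of pairs `biMap F`. -/
noncomputable def biComp (p q : C(CSpace N, CSpace N) × C(CSpace N, CSpace N)) :
    C(CSpace N, CSpace N) × C(CSpace N, CSpace N) :=
  (p.1.comp q.1, q.2.comp p.2)

theorem continuous_biComp : Continuous fun r : (C(CSpace N, CSpace N) × C(CSpace N, CSpace N)) ×
    (C(CSpace N, CSpace N) × C(CSpace N, CSpace N)) => biComp r.1 r.2 :=
  (ContinuousMap.continuous_comp'.comp
      ((continuous_fst.comp continuous_snd).prodMk (continuous_fst.comp continuous_fst))).prodMk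
    (ContinuousMap.continuous_comp'.comp
      ((continuous_snd.comp continuous_fst).prodMk (continuous_snd.comp continuous_snd)))

theorem biMap_mul (F G : HolAut N) : biMap (F * G) = biComp (biMap F) (biMap G) := by
  rw [biMap, mul_inv_rev]
  rfl

theorem biMap_inv (F : HolAut N) : biMap F⁻¹ = (biMap F).swap := by
  rw [biMap, inv_inv]
  rfl

/-- The closure of a group of automorphisms for locally uniform convergence of automorphisms
together with their inverses. Controlling the inverses makes it a subgroup without appeal to the
continuity of inversion in the compact-open topology. -/
noncomputable def biClosure (Γ : Subgroup (HolAut N)) : Subgroup (HolAut N) where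
  carrier := {F | biMap F ∈ closure (biMap '' (Γ : Set (HolAut N)))}
  mul_mem' := by
    intro F G hF hG
    rw [Set.mem_ofPred_eq, biMap_mul]
    refine map_mem_closure₂ continuous_biComp hF hG ?_
    rintro _ ⟨F', hF', rfl⟩ _ ⟨G', hG', rfl⟩
    exact ⟨F' * G', Γ.mul_mem hF' hG', biMap_mul _ _⟩
  one_mem' := subset_closure ⟨1, Γ.one_mem, rfl⟩
  inv_mem' := by
    intro F hF
    rw [Set.mem_ofPred_eq, biMap_inv]
    refine map_mem_closure continuous_swap hF ?_
    rintro _ ⟨F', hF', rfl⟩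
    exact ⟨F'⁻¹, Γ.inv_mem hF', biMap_inv _⟩

theorem mem_biClosure_iff {Γ : Subgroup (HolAut N)} {F : HolAut N} :
    F ∈ biClosure Γ ↔ biMap F ∈ closure (biMap '' (Γ : Set (HolAut N))) := Iff.rfl

/-- The closure `biClosure` is contained in the closure for the compact-open topology. -/
theorem mem_closure_of_mem_biClosure {Γ : Subgroup (HolAut N)} {F : HolAut N}
    (h : F ∈ biClosure Γ) : F ∈ closure (Γ : Set (HolAut N)) := by
  rw [closure_induced]
  have hmaps : Set.MapsTo Prod.fst (biMap '' (Γ : Set (HolAut N)))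
      (toContinuousMap '' (Γ : Set (HolAut N))) := by
    rintro _ ⟨G, hG, rfl⟩
    exact ⟨G, hG, rfl⟩
  exact map_mem_closure (x := biMap F) continuous_fst h hmaps

theorem mem_biClosure_of_tendsto {ι : Type*} {l : Filter ι} [l.NeBot] {Γ : Subgroup (HolAut N)}
    {G : ι → HolAut N} {F : HolAut N} (hG : ∀ i, G i ∈ Γ)
    (h : Tendsto (fun i => biMap (G i)) l (𝓝 (biMap F))) : F ∈ biClosure Γ :=
  mem_closure_of_tendsto h (Eventually.of_forall fun i => ⟨G i, hG i, rfl⟩)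

theorem tendsto_biMap_mul {ι : Type*} {l : Filter ι} {F G : ι → HolAut N} {F₀ G₀ : HolAut N}
    (hF : Tendsto (fun i => biMap (F i)) l (𝓝 (biMap F₀)))
    (hG : Tendsto (fun i => biMap (G i)) l (𝓝 (biMap G₀))) :
    Tendsto (fun i => biMap (F i * G i)) l (𝓝 (biMap (F₀ * G₀))) := by
  simp only [biMap_mul]
  exact (continuous_biComp.tendsto (biMap F₀, biMap G₀)).comp (hF.prodMk_nhds hG)

theorem tendsto_biMap_inv {ι : Type*} {l : Filter ι} {F : ι → HolAut N} {F₀ : HolAut N}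
    (hF : Tendsto (fun i => biMap (F i)) l (𝓝 (biMap F₀))) :
    Tendsto (fun i => biMap (F i)⁻¹) l (𝓝 (biMap F₀⁻¹)) := by
  simp only [biMap_inv]
  exact (continuous_swap.tendsto _).comp hF

theorem continuous_snoc {X : Type*} [TopologicalSpace X] {u : X → CSpace n} {v : X → ℂ}
    (hu : Continuous u) (hv : Continuous v) :
    Continuous fun x => (Fin.snoc (u x) (v x) : CSpace (n + 1)) := by
  refine continuous_pi fun i => ?_
  refine Fin.lastCases ?_ (fun j => ?_) i
  · simpa using hv
  · simpa [Function.comp_def] using (continuous_apply j).comp hu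

/-- The overshear with parameters `q.1`, `q.2` and its inverse depend continuously on the
parameters. -/
theorem continuous_biMap_axisOvershear {X : Type*} [TopologicalSpace X]
    (q : X → C(CSpace n, ℂ) × C(CSpace n, ℂ)) (hq : Continuous q)
    (hf : ∀ x, Differentiable ℂ (q x).1) (hg : ∀ x, Differentiable ℂ (q x).2) :
    Continuous fun x => biMap (axisOvershear (q x).1 (q x).2 (hf x) (hg x)) := by
  have hinit : Continuous fun p : X × CSpace (n + 1) => (Fin.init p.2 : CSpace n) :=
    differentiable_init.continuous.comp continuous_snd
  have h1 : Continuous fun p : X × CSpace (n + 1) => (q p.1).1 (Fin.init p.2) :=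
    (continuous_fst.comp (hq.comp continuous_fst)).eval hinit
  have h2 : Continuous fun p : X × CSpace (n + 1) => (q p.1).2 (Fin.init p.2) :=
    (continuous_snd.comp (hq.comp continuous_fst)).eval hinit
  have h3 : Continuous fun p : X × CSpace (n + 1) => p.2 (Fin.last n) := by fun_prop
  refine Continuous.prodMk (ContinuousMap.continuous_of_continuous_uncurry _ ?_)
    (ContinuousMap.continuous_of_continuous_uncurry _ ?_)
  · exact continuous_snoc hinit ((h1.cexp.mul h3).add h2)
  · exact continuous_snoc hinit (h1.neg.cexp.mul (h3.sub h2))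

theorem tendsto_biMap_axisOvershear {ι : Type*} {l : Filter ι} {f g : ι → CSpace n → ℂ}
    {f₀ g₀ : CSpace n → ℂ} (hf : ∀ i, Differentiable ℂ (f i)) (hg : ∀ i, Differentiable ℂ (g i))
    (hf₀ : Differentiable ℂ f₀) (hg₀ : Differentiable ℂ g₀)
    (h1 : Tendsto (fun i => (⟨f i, (hf i).continuous⟩ : C(CSpace n, ℂ))) l
      (𝓝 ⟨f₀, hf₀.continuous⟩))
    (h2 : Tendsto (fun i => (⟨g i, (hg i).continuous⟩ : C(CSpace n, ℂ))) l
      (𝓝 ⟨g₀, hg₀.continuous⟩)) :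
    Tendsto (fun i => biMap (axisOvershear (f i) (g i) (hf i) (hg i))) l
      (𝓝 (biMap (axisOvershear f₀ g₀ hf₀ hg₀))) := by
  let X := {q : C(CSpace n, ℂ) × C(CSpace n, ℂ) // Differentiable ℂ q.1 ∧ Differentiable ℂ q.2}
  have hc := continuous_biMap_axisOvershear (X := X) Subtype.val continuous_subtype_val
    (fun x => x.2.1) fun x => x.2.2
  let x₀ : X := ⟨(⟨f₀, hf₀.continuous⟩, ⟨g₀, hg₀.continuous⟩), hf₀, hg₀⟩
  let x : ι → X := fun i =>
    ⟨(⟨f i, (hf i).continuous⟩, ⟨g i, (hg i).continuous⟩), hf i, hg i⟩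
  have hx : Tendsto x l (𝓝 x₀) := tendsto_subtype_rng.2 (h1.prodMk_nhds h2)
  have h := (hc.tendsto x₀).comp hx
  simp only [Function.comp_def] at h
  exact h

theorem tendsto_continuousMap_of_norm_sub_lt {E ι : Type*} [NormedAddCommGroup E] {l : Filter ι}
    {h : ι → C(E, ℂ)} {t : C(E, ℂ)}
    (H : ∀ R, ∀ ε > 0, ∀ᶠ i in l, ∀ y, ‖y‖ ≤ R → ‖h i y - t y‖ < ε) : Tendsto h l (𝓝 t) := by
  rw [ContinuousMap.tendsto_iff_forall_isCompact_tendstoUniformlyOn]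
  intro K hK
  rw [Metric.tendstoUniformlyOn_iff]
  intro ε hε
  obtain ⟨R, hR⟩ := hK.isBounded.exists_norm_le
  filter_upwards [H R ε hε] with i hi y hy
  rw [dist_comm, dist_eq_norm]
  exact hi y (hR y hy)

/-! ### The second generator -/

/-- The vector `(1, 2, 4, …, 2 ^ n)`. The shift property `2 * w i = w (i + 1)` makes
`2 • w - twist w` a multiple of the last coordinate vector. -/
def baseVector (n : ℕ) : CSpace (n + 1) := fun i => 2 ^ (i : ℕ)

/-- The sum of the first and the last coordinate. -/
def endSum (n : ℕ) : CSpace (n + 1) →ₗ[ℂ] ℂ :=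
  (LinearMap.proj 0 : CSpace (n + 1) →ₗ[ℂ] ℂ) + LinearMap.proj (Fin.last n)

theorem endSum_apply (z : CSpace (n + 1)) : endSum n z = z 0 + z (Fin.last n) := rfl

/-- The direction of the conjugating shear, on which `endSum` vanishes. -/
def endDiff (n : ℕ) : CSpace (n + 1) := Pi.single (Fin.last n) 1 - Pi.single 0 1

theorem zero_ne_last (hn : 1 ≤ n) : (0 : Fin (n + 1)) ≠ Fin.last n := by
  simp [Fin.ext_iff]; omega

theorem endSum_endDiff (hn : 1 ≤ n) : endSum n (endDiff n) = 0 := by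
  simp [endSum_apply, endDiff, zero_ne_last hn, (zero_ne_last hn).symm]

theorem endSum_baseVector (n : ℕ) : endSum n (baseVector n) = 1 + 2 ^ n := by
  simp [endSum_apply, baseVector]

/-- The shear `z ↦ z + h (endSum z) • endDiff`, written as a conjugate of a shear in direction of
the last axis. -/
noncomputable def endShear (hn : 1 ≤ n) (h : ℂ → ℂ) (hh : Differentiable ℂ h) : HolAut (n + 1) :=
  (linear (Matrix.SpecialLinearGroup.transvection (zero_ne_last hn) 1))⁻¹ *
    axisShear (fun y : CSpace n => h (y ⟨0, hn⟩)) (hh.comp (by fun_prop)) *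
    linear (Matrix.SpecialLinearGroup.transvection (zero_ne_last hn) 1)

theorem endShear_apply (hn : 1 ≤ n) {h : ℂ → ℂ} (hh : Differentiable ℂ h) (z : CSpace (n + 1)) :
    (endShear hn h hh).1 z = z + h (endSum n z) • endDiff n := by
  rw [endShear, linear_inv, Matrix.SpecialLinearGroup.transvection_inv, mul_apply, mul_apply,
    transvection_apply, axisShear_apply, transvection_apply]
  have h0 : (Fin.init (z + (1 * z (Fin.last n)) • Pi.single 0 1 : CSpace (n + 1)) : CSpace n)
      ⟨0, hn⟩ = endSum n z := by
    have : (Fin.castSucc ⟨0, hn⟩ : Fin (n + 1)) = 0 := rfl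
    simp [Fin.init, endSum_apply, this]
  rw [h0]
  have h1 := (zero_ne_last hn).symm
  simp only [Pi.add_apply, Pi.smul_apply, Pi.single_eq_same, Pi.single_eq_of_ne h1, endDiff]
  module

theorem endShear_inv (hn : 1 ≤ n) {h : ℂ → ℂ} (hh : Differentiable ℂ h) :
    (endShear hn h hh)⁻¹ = endShear hn (fun ζ => -h ζ) hh.neg := by
  refine inv_eq_of_mul_eq_one_left (ext fun z => ?_)
  rw [mul_apply, endShear_apply, endShear_apply, map_add, map_smul, endSum_endDiff hn, smul_zero,
    add_zero, one_apply]
  module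

/-- A translation conjugates `endShear h` into the same shear for a translate of `h`. -/
theorem translation_pow_conj_endShear (hn : 1 ≤ n) {h : ℂ → ℂ} (hh : Differentiable ℂ h) (k : ℕ) :
    translation (baseVector n) ^ k * endShear hn h hh * (translation (baseVector n) ^ k)⁻¹ =
      endShear hn (fun ζ => h (ζ - (k * (1 + 2 ^ n) : ℝ))) (hh.comp (by fun_prop)) := by
  refine ext fun z => ?_
  rw [translation_pow, translation_inv, mul_apply, mul_apply, endShear_apply, endShear_apply,
    translation_apply, translation_apply, map_add, map_neg, map_smul, endSum_baseVector,
    smul_eq_mul]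
  push_cast
  rw [← sub_eq_add_neg (endSum n z)]
  module

theorem tendsto_biMap_endShear (hn : 1 ≤ n) {ι : Type*} {l : Filter ι} {h : ι → ℂ → ℂ}
    (hh : ∀ i, Differentiable ℂ (h i))
    (H : ∀ R, ∀ ε > 0, ∀ᶠ i in l, ∀ ζ, ‖ζ‖ ≤ R → ‖h i ζ‖ < ε) :
    Tendsto (fun i => biMap (endShear hn (h i) (hh i))) l (𝓝 (biMap 1)) := by
  have h1 : (1 : HolAut (n + 1)) =
      (linear (Matrix.SpecialLinearGroup.transvection (zero_ne_last hn) 1))⁻¹ *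
      axisOvershear (n := n) (fun _ => 0) (fun _ => 0) (differentiable_const 0)
        (differentiable_const 0) *
      linear (Matrix.SpecialLinearGroup.transvection (zero_ne_last hn) 1) := by
    rw [axisOvershear_one]; group
  rw [h1]
  refine tendsto_biMap_mul (tendsto_biMap_mul tendsto_const_nhds ?_) tendsto_const_nhds
  refine tendsto_biMap_axisOvershear _ _ _ _ tendsto_const_nhds ?_
  refine tendsto_continuousMap_of_norm_sub_lt fun R ε hε => ?_
  filter_upwards [H R ε hε] with i hi y hy
  simpa using hi _ ((norm_le_pi_norm y _).trans hy)

/-- Multiplied by powers of the translation from both sides, a twisted overshear becomes the one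
for translates of the parameters. The powers `2 * k` and `k` match because `2 • w - twist w` is a
multiple of the last coordinate vector. -/
theorem translation_pow_mul_twisted {f g : CSpace n → ℂ} (hf : Differentiable ℂ f)
    (hg : Differentiable ℂ g) (k : ℕ) {f' g' : CSpace n → ℂ} (hf' : Differentiable ℂ f')
    (hg' : Differentiable ℂ g')
    (hff : ∀ y, f' y = f (y - ((2 * k : ℝ) : ℂ) • (Fin.init (baseVector n) : CSpace n)))
    (hgg : ∀ y, g' y = g (y - ((2 * k : ℝ) : ℂ) • (Fin.init (baseVector n) : CSpace n)) +
      Complex.exp (f' y) * (k * (-1) ^ (n + 1)) + 2 * k * 2 ^ n) :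
    translation (baseVector n) ^ (2 * k) * (axisOvershear f g hf hg * twist n) *
      (translation (baseVector n) ^ k)⁻¹ = axisOvershear f' g' hf' hg' * twist n := by
  refine ext fun z => ?_
  rw [translation_pow, translation_pow, translation_inv]
  simp only [mul_apply, translation_apply, twist_apply, axisOvershear_apply]
  have h1 : (Fin.init (Fin.snoc (Fin.tail (z + -((k : ℂ) • baseVector n)))
      (-(-1) ^ (n + 1) * (z + -((k : ℂ) • baseVector n)) 0) : CSpace (n + 1)) : CSpace n) =
      Fin.tail z - ((2 * k : ℝ) : ℂ) • (Fin.init (baseVector n) : CSpace n) := by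
    rw [Fin.init_snoc]
    funext i
    simp only [Fin.tail, Fin.init, baseVector, Pi.add_apply, Pi.neg_apply, Pi.smul_apply,
      Pi.sub_apply, smul_eq_mul, Fin.val_succ, Fin.val_castSucc, pow_succ]
    push_cast
    ring
  rw [h1, Fin.init_snoc, hgg, hff, Fin.snoc_last, Fin.snoc_last]
  funext i
  refine Fin.lastCases ?_ (fun j => ?_) i
  · simp only [Fin.snoc_last, Pi.add_apply, Pi.neg_apply, Pi.smul_apply, smul_eq_mul, baseVector,
      Fin.val_last, Fin.val_zero, pow_zero]
    push_cast
    ring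
  · simp only [Fin.snoc_castSucc, Pi.add_apply, Pi.smul_apply, smul_eq_mul, baseVector,
      Fin.val_castSucc, Pi.sub_apply, Fin.init]
    push_cast
    ring

end HolAut

/-! ### Density -/

namespace HolAut

variable {N n : ℕ}

/-- The exponents of the powers of the translation along which approximation takes place. They
grow fast enough for `exists_entire_approx_translates`. -/
def stepSize (j : ℕ) : ℕ := 8 ^ (j + 1)

theorem succ_le_stepSize (j : ℕ) : (j : ℝ) + 1 ≤ stepSize j / 2 := by
  induction j with
  | zero => norm_num [stepSize]
  | succ j ih =>
    simp only [stepSize, pow_succ] at ih ⊢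
    push_cast at ih ⊢
    linarith

/-- The translate of the point `y` at which the parameters are evaluated in
`translation_pow_mul_twisted` for `k = stepSize j`. -/
noncomputable def shiftBack (j : ℕ) (y : CSpace n) : CSpace n :=
  y - ((2 * stepSize j : ℝ) : ℂ) • (Fin.init (baseVector n) : CSpace n)

theorem differentiable_shiftBack (j : ℕ) :
    Differentiable ℂ (shiftBack j : CSpace n → CSpace n) := by
  unfold shiftBack; fun_prop

/-- Birkhoff's theorem in the form used here: an entire function with approximately prescribed
translates. -/
theorem exists_entire_approx_shiftBack (hn : 1 ≤ n) (t : ℕ → CSpace n → ℂ)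
    (ht : ∀ j, Differentiable ℂ (t j)) :
    ∃ g : CSpace n → ℂ, Differentiable ℂ g ∧
      ∀ (j : ℕ) y, ‖y‖ ≤ (j : ℝ) + 1 → ‖g (shiftBack j y) - t j y‖ ≤ 2 * (1 / 2) ^ j := by
  have h1 := succ_le_stepSize
  refine exists_entire_approx_translates
    (ContinuousLinearMap.proj (⟨0, hn⟩ : Fin n) : CSpace n →L[ℂ] ℂ)
    (v := (Fin.init (baseVector n) : CSpace n)) (by simp [Fin.init, baseVector])
    (b := fun j => 2 * stepSize j) (R := fun j => (j : ℝ) + 1) (fun j => ?_) (fun j => ?_)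
    (fun j => ?_) (fun j y hy => ?_) t ht
  · linarith [h1 j, (Nat.cast_nonneg j : (0 : ℝ) ≤ j)]
  · simp only [stepSize, pow_succ]
    push_cast
    have : (0 : ℝ) ≤ 8 ^ j := by positivity
    linarith
  · linarith [h1 j, (Nat.cast_nonneg j : (0 : ℝ) ≤ j)]
  · have h2 : ‖(ContinuousLinearMap.proj (⟨0, hn⟩ : Fin n) : CSpace n →L[ℂ] ℂ) y‖ ≤ ‖y‖ :=
      norm_le_pi_norm y _
    linarith [h1 j]

/-- A class of entire functions from which the exponents of overshears are taken, and in which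
translates can be approximately prescribed: the zero function alone in the case of shears, all
entire functions in the case of overshears. -/
structure IsExponentClass (𝓕 : Set (CSpace n → ℂ)) : Prop where
  differentiable : ∀ f ∈ 𝓕, Differentiable ℂ f
  zero_mem : (fun _ => 0) ∈ 𝓕
  approx : ∀ t : ℕ → CSpace n → ℂ, (∀ j, t j ∈ 𝓕) → ∃ f ∈ 𝓕,
    ∀ (j : ℕ) y, ‖y‖ ≤ (j : ℝ) + 1 → ‖f (shiftBack j y) - t j y‖ ≤ 2 * (1 / 2) ^ j

theorem isExponentClass_zero : IsExponentClass ({fun _ => 0} : Set (CSpace n → ℂ)) where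
  differentiable f hf := by rw [Set.mem_singleton_iff.1 hf]; exact differentiable_const 0
  zero_mem := rfl
  approx t ht := ⟨_, rfl, fun j y _ => by rw [Set.mem_singleton_iff.1 (ht j)]; simp⟩

theorem isExponentClass_entire (hn : 1 ≤ n) :
    IsExponentClass {f : CSpace n → ℂ | Differentiable ℂ f} where
  differentiable _ hf := hf
  zero_mem := differentiable_const 0
  approx t ht := exists_entire_approx_shiftBack hn t ht

/-- A function tends to zero locally uniformly along real translations to the left. -/
def DecaysLeft (h : ℂ → ℂ) : Prop :=
  ∀ R, ∀ ε > 0, ∀ᶠ b : ℝ in atTop, ∀ ζ, ‖ζ‖ ≤ R → ‖h (ζ - b)‖ < ε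

theorem decaysLeft_decayingSeries (x : BoundedContinuousFunction ℕ ℂ) :
    DecaysLeft (decayingSeries x) := by
  intro R ε hε
  have h1 : Tendsto (fun b : ℝ => ‖x‖ * Real.exp (2 * R - b / 2)) atTop (𝓝 (‖x‖ * 0)) := by
    refine Tendsto.const_mul _ (Real.tendsto_exp_atBot.comp ?_)
    refine tendsto_atBot_add_const_left _ (2 * R) ?_ |>.congr fun b => (sub_eq_add_neg _ _).symm
    exact tendsto_neg_atTop_atBot.comp (tendsto_id.atTop_div_const two_pos)
  rw [mul_zero] at h1
  filter_upwards [h1.eventually_lt_const hε, eventually_ge_atTop 0] with b hb hb0 ζ hζ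
  refine (norm_decayingSeries_sub_le x hb0).trans_lt (lt_of_le_of_lt ?_ hb)
  gcongr

/-- The sum of the coordinates. -/
noncomputable def coordSum (n : ℕ) : CSpace n →ₗ[ℂ] ℂ := ∑ i, LinearMap.proj i

theorem coordSum_apply (y : CSpace n) : coordSum n y = ∑ i, y i := by
  simp [coordSum]

theorem differentiable_coordSum : Differentiable ℂ (coordSum n) :=
  (coordSum n).toContinuousLinearMap.differentiable

theorem norm_coordSum_le (y : CSpace n) : ‖coordSum n y‖ ≤ n * ‖y‖ := by
  rw [coordSum_apply]
  refine (norm_sum_le_of_le _ fun i _ => norm_le_pi_norm y i).trans (le_of_eq ?_)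
  simp

theorem coordSum_init_baseVector (n : ℕ) :
    coordSum n (Fin.init (baseVector n)) = ((2 ^ n - 1 : ℝ) : ℂ) := by
  rw [coordSum_apply]
  simp only [Fin.init, baseVector, Fin.val_castSucc]
  rw [Fin.sum_univ_eq_sum_range (fun i => (2 : ℂ) ^ i), geom_sum_eq (by norm_num)]
  push_cast
  norm_num

/-- The second generator: a twisted overshear with parameters `f` and `g + h₂ ∘ coordSum`,
conjugated by the shear `endShear h₁`. -/
noncomputable def twistedGenerator (hn : 1 ≤ n) {f g : CSpace n → ℂ} {h₁ h₂ : ℂ → ℂ}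
    (hf : Differentiable ℂ f) (hg : Differentiable ℂ g) (hh₁ : Differentiable ℂ h₁)
    (hh₂ : Differentiable ℂ h₂) : HolAut (n + 1) :=
  (endShear hn h₁ hh₁)⁻¹ *
    (axisOvershear f (fun y => g y + h₂ (coordSum n y)) hf
      (hg.add (hh₂.comp differentiable_coordSum)) * twist n) * endShear hn h₁ hh₁

theorem tendsto_biMap_conj_endShear (hn : 1 ≤ n) {h : ℂ → ℂ} (hh : Differentiable ℂ h)
    (hdec : DecaysLeft h) {k : ℕ → ℕ} (hk : Tendsto k atTop atTop) :
    Tendsto (fun i => biMap (translation (baseVector n) ^ k i * endShear hn h hh *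
      (translation (baseVector n) ^ k i)⁻¹)) atTop (𝓝 (biMap 1)) := by
  simp only [translation_pow_conj_endShear]
  refine tendsto_biMap_endShear hn _ fun R ε hε => ?_
  have h1 : Tendsto (fun i => (k i * (1 + 2 ^ n) : ℝ)) atTop atTop :=
    (tendsto_natCast_atTop_atTop.comp hk).atTop_mul_const (by positivity)
  exact h1.eventually (hdec R ε hε)

theorem mul_conj_mul_eq {G : Type*} [Group G] (a b p x : G) :
    a * (p⁻¹ * x * p) * b⁻¹ = (a * p * a⁻¹)⁻¹ * (a * x * b⁻¹) * (b * p * b⁻¹) := by group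

theorem tendsto_stepSize : Tendsto stepSize atTop atTop :=
  tendsto_atTop_mono (fun j => (Nat.le_succ j).trans (Nat.lt_pow_self (by norm_num)).le) tendsto_id

/-- If the parameters of the second generator approximate `f₀` and, up to the correction caused by
the translation, `g₀` along a sequence of translates, then the overshear with parameters `f₀`, `g₀`
composed with the twist is a limit of group elements. -/
theorem axisOvershear_mul_twist_mem (hn : 1 ≤ n) {f g f₀ g₀ : CSpace n → ℂ} {h₁ h₂ : ℂ → ℂ}
    (hf : Differentiable ℂ f) (hg : Differentiable ℂ g) (hf₀ : Differentiable ℂ f₀)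
    (hg₀ : Differentiable ℂ g₀) (hh₁ : Differentiable ℂ h₁) (hh₂ : Differentiable ℂ h₂)
    (hd₁ : DecaysLeft h₁) (hd₂ : DecaysLeft h₂) {φ : ℕ → ℕ} (hφ : Tendsto φ atTop atTop)
    (hfa : ∀ i y, ‖y‖ ≤ (φ i : ℝ) + 1 → ‖f (shiftBack (φ i) y) - f₀ y‖ ≤ 2 * (1 / 2) ^ φ i)
    (hga : ∀ i y, ‖y‖ ≤ (φ i : ℝ) + 1 → ‖g (shiftBack (φ i) y) - (g₀ y -
      (Complex.exp (f (shiftBack (φ i) y)) * (stepSize (φ i) * (-1) ^ (n + 1)) +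
        2 * stepSize (φ i) * 2 ^ n))‖ ≤ 2 * (1 / 2) ^ φ i) :
    axisOvershear f₀ g₀ hf₀ hg₀ * twist n ∈ biClosure (Subgroup.closure
      {translation (baseVector n), twistedGenerator hn hf hg hh₁ hh₂}) := by
  obtain ⟨F, hF⟩ : ∃ F, F = twistedGenerator hn hf hg hh₁ hh₂ := ⟨_, rfl⟩
  rw [← hF]
  obtain ⟨Γ, hΓ⟩ : ∃ Γ, Γ = Subgroup.closure {translation (baseVector n), F} := ⟨_, rfl⟩
  rw [← hΓ]
  have hτΓ : translation (baseVector n) ∈ Γ := hΓ ▸ Subgroup.subset_closure (by simp)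
  have hFΓ : F ∈ Γ := hΓ ▸ Subgroup.subset_closure (by simp)
  let f' : ℕ → CSpace n → ℂ := fun i y => f (shiftBack (φ i) y)
  let g' : ℕ → CSpace n → ℂ := fun i y =>
    g (shiftBack (φ i) y) + h₂ (coordSum n (shiftBack (φ i) y)) +
      Complex.exp (f' i y) * (stepSize (φ i) * (-1) ^ (n + 1)) + 2 * stepSize (φ i) * 2 ^ n
  have hf' : ∀ i, Differentiable ℂ (f' i) := fun i => hf.comp (differentiable_shiftBack _)
  have hg' : ∀ i, Differentiable ℂ (g' i) := fun i =>
    (((hg.comp (differentiable_shiftBack _)).add (hh₂.comp (differentiable_coordSum.comp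
      (differentiable_shiftBack _)))).add ((hf' i).cexp.mul_const _)).add_const _
  have hmem : ∀ i, translation (baseVector n) ^ (2 * stepSize (φ i)) * F *
      (translation (baseVector n) ^ stepSize (φ i))⁻¹ ∈ Γ := fun i =>
    Γ.mul_mem (Γ.mul_mem (Γ.pow_mem hτΓ _) hFΓ) (Γ.inv_mem (Γ.pow_mem hτΓ _))
  have hstep : Tendsto (fun i => stepSize (φ i)) atTop atTop := tendsto_stepSize.comp hφ
  have hstep2 : Tendsto (fun i => 2 * stepSize (φ i)) atTop atTop :=
    tendsto_atTop_mono (fun i => Nat.le_mul_of_pos_left _ two_pos) hstep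
  have hpow : Tendsto (fun i => 2 * (1 / 2 : ℝ) ^ φ i) atTop (𝓝 0) := by
    have := ((tendsto_pow_atTop_nhds_zero_of_lt_one (r := (1 / 2 : ℝ)) (by norm_num)
      (by norm_num)).const_mul 2).comp hφ
    simpa [Function.comp_def] using this
  have hR : ∀ R : ℝ, ∀ᶠ i in atTop, R ≤ (φ i : ℝ) + 1 := fun R =>
    (tendsto_atTop_add_const_right _ 1
      (tendsto_natCast_atTop_atTop.comp hφ)).eventually_ge_atTop R
  have hf'lim : Tendsto (fun i => (⟨f' i, (hf' i).continuous⟩ : C(CSpace n, ℂ))) atTop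
      (𝓝 ⟨f₀, hf₀.continuous⟩) := by
    refine tendsto_continuousMap_of_norm_sub_lt fun R ε hε => ?_
    filter_upwards [hR R, hpow.eventually_lt_const hε] with i hi hlt y hy
    exact (hfa i y (hy.trans hi)).trans_lt hlt
  have hg'lim : Tendsto (fun i => (⟨g' i, (hg' i).continuous⟩ : C(CSpace n, ℂ))) atTop
      (𝓝 ⟨g₀, hg₀.continuous⟩) := by
    refine tendsto_continuousMap_of_norm_sub_lt fun R ε hε => ?_
    have hpos : (0 : ℝ) < 2 ^ n - 1 := by
      have : (1 : ℝ) < 2 ^ n := one_lt_pow₀ (by norm_num) (by omega)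
      linarith
    have hb : Tendsto (fun i => (2 * stepSize (φ i) : ℝ) * (2 ^ n - 1)) atTop atTop :=
      Tendsto.atTop_mul_const hpos
        ((tendsto_natCast_atTop_atTop.comp hstep).const_mul_atTop two_pos)
    filter_upwards [hR R, hpow.eventually_lt_const (half_pos hε),
      hb.eventually (hd₂ (n * R) (ε / 2) (half_pos hε))] with i hi hlt hdec y hy
    have h1 := hga i y (hy.trans hi)
    have h2 := hdec (coordSum n y)
      ((norm_coordSum_le y).trans (mul_le_mul_of_nonneg_left hy (Nat.cast_nonneg n)))
    have h3 : coordSum n (shiftBack (φ i) y) =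
        coordSum n y - (((2 * stepSize (φ i) : ℝ) * (2 ^ n - 1) : ℝ) : ℂ) := by
      rw [shiftBack, map_sub, map_smul, coordSum_init_baseVector, smul_eq_mul]
      push_cast
      ring
    have h4 : g' i y - g₀ y = (g (shiftBack (φ i) y) - (g₀ y -
        (Complex.exp (f (shiftBack (φ i) y)) * (stepSize (φ i) * (-1) ^ (n + 1)) +
          2 * stepSize (φ i) * 2 ^ n))) + h₂ (coordSum n (shiftBack (φ i) y)) := by
      simp only [g', f']
      ring
    change ‖g' i y - g₀ y‖ < ε
    rw [h4]
    refine (norm_add_le _ _).trans_lt ?_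
    rw [h3]
    linarith
  have hlim := tendsto_biMap_mul (tendsto_biMap_mul
    (tendsto_biMap_inv (tendsto_biMap_conj_endShear hn hh₁ hd₁ hstep2))
    (tendsto_biMap_mul (tendsto_biMap_axisOvershear hf' hg' hf₀ hg₀ hf'lim hg'lim)
      (tendsto_const_nhds (x := biMap (twist n)))))
    (tendsto_biMap_conj_endShear hn hh₁ hd₁ hstep)
  rw [inv_one, one_mul, mul_one] at hlim
  refine mem_biClosure_of_tendsto hmem (hlim.congr fun i => ?_)
  rw [← translation_pow_mul_twisted hf (hg.add (hh₂.comp differentiable_coordSum))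
    (stepSize (φ i)) (hf' i) (hg' i) (fun y => rfl) (fun y => rfl), hF, twistedGenerator,
    mul_conj_mul_eq]
  rfl

/-- For suitable parameters `f` and `g`, and independently of decaying perturbations, all overshears
in direction of the last axis composed with the twist are limits of elements of the group generated
by the translation and the second generator. -/
theorem exists_axisOvershear_mul_twist_mem (hn : 1 ≤ n) {𝓕 : Set (CSpace n → ℂ)}
    (h𝓕 : IsExponentClass 𝓕) :
    ∃ (f g : CSpace n → ℂ) (hf : Differentiable ℂ f) (hg : Differentiable ℂ g), f ∈ 𝓕 ∧
      ∀ (h₁ h₂ : ℂ → ℂ) (hh₁ : Differentiable ℂ h₁) (hh₂ : Differentiable ℂ h₂),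
        DecaysLeft h₁ → DecaysLeft h₂ →
        ∀ (f₀ g₀ : CSpace n → ℂ) (hf₀ : Differentiable ℂ f₀) (hg₀ : Differentiable ℂ g₀), f₀ ∈ 𝓕 →
          axisOvershear f₀ g₀ hf₀ hg₀ * twist n ∈ biClosure (Subgroup.closure
            {translation (baseVector n), twistedGenerator hn hf hg hh₁ hh₂}) := by
  let S : Set (C(CSpace n, ℂ) × C(CSpace n, ℂ)) := {q | ⇑q.1 ∈ 𝓕 ∧ Differentiable ℂ q.2}
  have hne : Nonempty S := ⟨⟨(⟨fun _ => 0, continuous_const⟩, ⟨fun _ => 0, continuous_const⟩),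
    h𝓕.zero_mem, differentiable_const 0⟩⟩
  obtain ⟨s, hs⟩ := TopologicalSpace.exists_dense_seq S
  have hsd : ∀ x : S, Differentiable ℂ x.1.1 := fun x => h𝓕.differentiable _ x.2.1
  -- each term of the dense sequence is the target of infinitely many steps
  obtain ⟨q, hq⟩ : ∃ q : ℕ → S, ∀ m i, q (Nat.pair m i) = s m :=
    ⟨fun j => s (Nat.unpair j).1, fun m i => by simp⟩
  obtain ⟨f, hf𝓕, hfa⟩ := h𝓕.approx (fun j => (q j).1.1) fun j => (q j).2.1
  have hf := h𝓕.differentiable f hf𝓕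
  -- the functions prescribed for `g` compensate the correction term, which depends on `f`
  obtain ⟨g, hg, hga⟩ := exists_entire_approx_shiftBack hn
    (fun j y => (q j).1.2 y -
      (Complex.exp (f (shiftBack j y)) * (stepSize j * (-1) ^ (n + 1)) + 2 * stepSize j * 2 ^ n))
    fun j => (q j).2.2.sub
      (((hf.comp (differentiable_shiftBack j)).cexp.mul_const _).add_const _)
  refine ⟨f, g, hf, hg, hf𝓕, fun h₁ h₂ hh₁ hh₂ hd₁ hd₂ => ?_⟩
  have hseq : ∀ m, axisOvershear (s m).1.1 (s m).1.2 (hsd _) (s m).2.2 * twist n ∈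
      biClosure (Subgroup.closure
        {translation (baseVector n), twistedGenerator hn hf hg hh₁ hh₂}) := by
    intro m
    refine axisOvershear_mul_twist_mem hn hf hg (hsd _) (s m).2.2 hh₁ hh₂ hd₁ hd₂
      (φ := fun i => Nat.pair m i)
      (tendsto_atTop_mono (fun i => Nat.right_le_pair m i) tendsto_id) (fun i y hy => ?_)
      fun i y hy => ?_
    · have := hfa (Nat.pair m i) y hy
      rwa [hq] at this
    · have := hga (Nat.pair m i) y hy
      rwa [hq] at this
  intro f₀ g₀ hf₀ hg₀ hf₀𝓕
  have hcont : Continuous fun x : S =>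
      biMap (axisOvershear x.1.1 x.1.2 (hsd x) x.2.2 * twist n) := by
    simp only [biMap_mul]
    exact continuous_biComp.comp ((continuous_biMap_axisOvershear _ continuous_subtype_val
      hsd fun x => x.2.2).prodMk continuous_const)
  let x₀ : S := ⟨(⟨f₀, hf₀.continuous⟩, ⟨g₀, hg₀.continuous⟩), hf₀𝓕, hg₀⟩
  exact hs.induction_on (p := fun x : S =>
    biMap (axisOvershear x.1.1 x.1.2 (hsd x) x.2.2 * twist n) ∈ closure (biMap '' _)) x₀
    (isClosed_closure.preimage hcont) hseq

end HolAut

/-! ### Freeness -/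

namespace HolAut

variable {N n : ℕ}

theorem coordSum_tail_single_last (hn : 1 ≤ n) :
    coordSum n (Fin.tail (Pi.single (Fin.last n) 1 : CSpace (n + 1))) = 1 := by
  obtain ⟨m, rfl⟩ := Nat.exists_eq_add_of_le' hn
  rw [coordSum_apply, Finset.sum_eq_single (Fin.last m)]
  · simp [Fin.tail, ← Fin.succ_last]
  · intro i _ hi
    rw [Fin.tail, ← Fin.succ_last, Pi.single_eq_of_ne ((Fin.succ_injective _).ne hi)]
  · simp

theorem tail_single_zero : (Fin.tail (Pi.single 0 1 : CSpace (n + 1)) : CSpace n) = 0 := by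
  funext i
  simp [Fin.tail]

theorem init_single_last :
    (Fin.init (Pi.single (Fin.last n) 1 : CSpace (n + 1)) : CSpace n) = 0 := by
  funext i
  simp [Fin.init]

theorem coordSum_init_single_zero (hn : 1 ≤ n) :
    coordSum n (Fin.init (Pi.single 0 1 : CSpace (n + 1))) = 1 := by
  obtain ⟨m, rfl⟩ := Nat.exists_eq_add_of_le' hn
  rw [coordSum_apply, Finset.sum_eq_single 0]
  · simp [Fin.init]
  · intro i _ hi
    simpa [Fin.init, Pi.single_apply] using hi
  · simp

theorem neg_neg_one_pow_ne_zero (m : ℕ) : (-(-1 : ℂ) ^ m) ≠ 0 := by simp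

/-- The word model of the translation conjugated by `endShear` and of a twisted overshear. The
perturbation `h₂` enters the twisted overshear through the sum of the first `n` coordinates of the
image of the twist, and its inverse through the sum of the first `n` coordinates. -/
noncomputable def wordModel (hn : 1 ≤ n) {f g : CSpace n → ℂ} (hf : Differentiable ℂ f)
    (hg : Differentiable ℂ g) : WordModel (CSpace (n + 1)) where
  μ := endSum n
  w := baseVector n
  u := endDiff n
  ν δ := if δ then coordSum n ∘ₗ LinearMap.funLeft ℂ ℂ Fin.succ
    else coordSum n ∘ₗ LinearMap.funLeft ℂ ℂ Fin.castSucc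
  v δ := if δ then Pi.single (Fin.last n) 1 else (-(-1) ^ (n + 1) : ℂ) • Pi.single 0 1
  A δ z := if δ then (axisOvershear f g hf hg * twist n).1 z
    else ((axisOvershear f g hf hg * twist n)⁻¹).1 z
  κ δ z := if δ then 1 else -Complex.exp (-f (Fin.init z))
  μ_u := endSum_endDiff hn
  μ_w := by
    rw [endSum_baseVector]
    exact_mod_cast Nat.succ_ne_zero (2 ^ n) ∘ fun h => by omega
  μ_v δ := by
    have := zero_ne_last hn
    cases δ <;> simp [endSum_apply, this, this.symm]
  ν_u δ := by
    cases δ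
    · change coordSum n (Fin.init (endDiff n)) ≠ 0
      have : (Fin.init (endDiff n) : CSpace n) = Fin.init (Pi.single (Fin.last n) 1 : CSpace (n + 1)) -
        Fin.init (Pi.single 0 1 : CSpace (n + 1)) := by
        funext i; simp [Fin.init, endDiff]
      rw [this, map_sub, init_single_last, coordSum_init_single_zero hn]
      simp
    · change coordSum n (Fin.tail (endDiff n)) ≠ 0
      have : (Fin.tail (endDiff n) : CSpace n) = Fin.tail (Pi.single (Fin.last n) 1 : CSpace (n + 1)) -
        Fin.tail (Pi.single 0 1 : CSpace (n + 1)) := by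
        funext i; simp [Fin.tail, endDiff]
      rw [this, map_sub, tail_single_zero, coordSum_tail_single_last hn]
      simp
  ν_v δ := by
    cases δ
    · simp only [Bool.false_eq_true, if_false, map_smul]
      refine smul_ne_zero (neg_neg_one_pow_ne_zero _) ?_
      change coordSum n (Fin.init (Pi.single 0 1 : CSpace (n + 1))) ≠ 0
      rw [coordSum_init_single_zero hn]
      exact one_ne_zero
    · change coordSum n (Fin.tail (Pi.single (Fin.last n) 1 : CSpace (n + 1))) ≠ 0
      rw [coordSum_tail_single_last hn]
      exact one_ne_zero
  κ_ne δ z := by cases δ <;> simp [Complex.exp_ne_zero]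

section Generators

variable (hn : 1 ≤ n) {f g : CSpace n → ℂ} (hf : Differentiable ℂ f) (hg : Differentiable ℂ g)

theorem endShear_conj_translation_apply {h : ℂ → ℂ} (hh : Differentiable ℂ h) (w z : CSpace (n + 1)) :
    (endShear hn h hh * translation w * (endShear hn h hh)⁻¹).1 z =
      z + w + (h (endSum n z + endSum n w) - h (endSum n z)) • endDiff n := by
  rw [endShear_inv, mul_apply, mul_apply, endShear_apply, endShear_apply, translation_apply,
    map_add, map_add, map_smul, endSum_endDiff hn, smul_zero, add_zero]
  module

/-- The twisted overshear inside `twistedGenerator`. -/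
noncomputable def twistedOvershear {h : ℂ → ℂ} (hh : Differentiable ℂ h) : HolAut (n + 1) :=
  axisOvershear f (fun y => g y + h (coordSum n y)) hf (hg.add (hh.comp differentiable_coordSum)) *
    twist n

theorem twistedOvershear_apply {h : ℂ → ℂ} (hh : Differentiable ℂ h) (z : CSpace (n + 1)) :
    (twistedOvershear hf hg hh).1 z = (axisOvershear f g hf hg * twist n).1 z +
      h (coordSum n (Fin.tail z)) • Pi.single (Fin.last n) 1 := by
  rw [twistedOvershear, mul_apply, mul_apply, axisOvershear_apply, axisOvershear_apply, twist_apply,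
    Fin.init_snoc]
  funext i
  refine Fin.lastCases ?_ (fun j => ?_) i
  · simp [add_assoc]
  · simp

theorem twistedOvershear_inv_apply {h : ℂ → ℂ} (hh : Differentiable ℂ h) (z : CSpace (n + 1)) :
    ((twistedOvershear hf hg hh)⁻¹).1 z = ((axisOvershear f g hf hg * twist n)⁻¹).1 z +
      (-Complex.exp (-f (Fin.init z)) * h (coordSum n (Fin.init z))) •
        ((-(-1) ^ (n + 1) : ℂ) • Pi.single 0 1) := by
  rw [twistedOvershear, mul_inv_rev, mul_inv_rev, mul_apply, mul_apply, axisOvershear_inv_apply,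
    axisOvershear_inv_apply, twist_inv_apply, twist_inv_apply]
  funext i
  refine Fin.cases ?_ (fun j => ?_) i
  · simp only [Fin.cons_zero, Fin.snoc_last, Pi.add_apply, Pi.smul_apply, Pi.single_eq_same,
      smul_eq_mul]
    ring
  · simp

variable {h₁ h₂ : ℂ → ℂ} (hh₁ : Differentiable ℂ h₁) (hh₂ : Differentiable ℂ h₂)

theorem lift_apply_eq_eval (L : List (Fin 2 × Bool)) (z : CSpace (n + 1)) :
    (FreeGroup.lift ![endShear hn h₁ hh₁ * translation (baseVector n) * (endShear hn h₁ hh₁)⁻¹,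
      twistedOvershear hf hg hh₂] (FreeGroup.mk L)).1 z = (wordModel hn hf hg).eval h₁ h₂ L z := by
  rw [FreeGroup.lift_mk]
  induction L with
  | nil => rfl
  | cons a L ih =>
    rw [List.map_cons, List.prod_cons, mul_apply, ih]
    simp only [WordModel.eval, List.foldr_cons]
    obtain ⟨i, δ⟩ := a
    fin_cases i <;> cases δ
    · simp only [Fin.zero_eta, cond_false, Matrix.cons_val_zero]
      have : (endShear hn h₁ hh₁ * translation (baseVector n) * (endShear hn h₁ hh₁)⁻¹)⁻¹ =
          endShear hn h₁ hh₁ * translation (-baseVector n) * (endShear hn h₁ hh₁)⁻¹ := by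
        rw [← translation_inv]; group
      rw [this, endShear_conj_translation_apply]
      simp [WordModel.step, wordModel, WordModel.sgn]
    · simp only [Fin.zero_eta, cond_true, Matrix.cons_val_zero]
      rw [endShear_conj_translation_apply]
      simp [WordModel.step, wordModel, WordModel.sgn]
    · simp only [Fin.mk_one, cond_false, Matrix.cons_val_one, Matrix.cons_val_fin_one]
      rw [twistedOvershear_inv_apply]
      rfl
    · simp only [Fin.mk_one, cond_true, Matrix.cons_val_one, Matrix.cons_val_fin_one]
      rw [twistedOvershear_apply]
      simp only [WordModel.step, wordModel, if_true, one_mul]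
      rfl

theorem lift_eq_conj (W : FreeGroup (Fin 2)) :
    FreeGroup.lift ![translation (baseVector n), twistedGenerator hn hf hg hh₁ hh₂] W =
      (endShear hn h₁ hh₁)⁻¹ * FreeGroup.lift ![endShear hn h₁ hh₁ * translation (baseVector n) *
        (endShear hn h₁ hh₁)⁻¹, twistedOvershear hf hg hh₂] W * endShear hn h₁ hh₁ := by
  have h : FreeGroup.lift ![translation (baseVector n), twistedGenerator hn hf hg hh₁ hh₂] =
      (MulAut.conj (endShear hn h₁ hh₁)⁻¹).toMonoidHom.comp
        (FreeGroup.lift ![endShear hn h₁ hh₁ * translation (baseVector n) *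
        (endShear hn h₁ hh₁)⁻¹, twistedOvershear hf hg hh₂]) := by
    refine FreeGroup.ext_hom _ _ fun i => ?_
    fin_cases i
    · simp [mul_assoc]
    · simp [mul_assoc, twistedGenerator, twistedOvershear]
  rw [h]
  simp

/-- A relation between the generators is the triviality of the action of a word. -/
theorem lift_eq_one_iff (W : FreeGroup (Fin 2)) :
    FreeGroup.lift ![translation (baseVector n), twistedGenerator hn hf hg hh₁ hh₂] W = 1 ↔
      ∀ z, (wordModel hn hf hg).eval h₁ h₂ W.toWord z = z := by
  rw [lift_eq_conj]
  have h1 : ∀ P X : HolAut (n + 1), P⁻¹ * X * P = 1 ↔ X = 1 := fun P X => by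
    constructor
    · intro h
      have : X = P * (P⁻¹ * X * P) * P⁻¹ := by group
      rw [this, h]; group
    · rintro rfl; group
  rw [h1]
  have h2 := lift_apply_eq_eval hn hf hg hh₁ hh₂ W.toWord
  rw [FreeGroup.mk_toWord] at h2
  constructor
  · intro h z
    rw [← h2, h, one_apply]
  · intro h
    exact ext fun z => by rw [h2, h, one_apply]

end Generators

/-- The action of a word depends holomorphically on the point and on the coefficients of the
function parameters. -/
theorem differentiable_eval (hn : 1 ≤ n) {f g : CSpace n → ℂ} (hf : Differentiable ℂ f)
    (hg : Differentiable ℂ g) (L : List (Fin 2 × Bool)) (z : CSpace (n + 1)) :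
    Differentiable ℂ fun x : (ℕ →ᵇ ℂ) × (ℕ →ᵇ ℂ) =>
      (wordModel hn hf hg).eval (decayingSeries x.1) (decayingSeries x.2) L z := by
  have hlin : ∀ l : CSpace (n + 1) →ₗ[ℂ] ℂ, Differentiable ℂ l := fun l =>
    l.toContinuousLinearMap.differentiable
  induction L with
  | nil => exact differentiable_const z
  | cons a L ih =>
    simp only [WordModel.eval, List.foldr_cons] at ih ⊢
    obtain ⟨i, δ⟩ := a
    fin_cases i
    · have h1 := (hlin (wordModel hn hf hg).μ).comp ih
      have h2 := differentiable_decayingSeries.comp (differentiable_fst.prodMk h1)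
      have h3 := differentiable_decayingSeries.comp (differentiable_fst.prodMk
        (h1.add_const (WordModel.sgn δ * (wordModel hn hf hg).μ (wordModel hn hf hg).w)))
      exact (ih.add_const _).add ((h3.sub h2).smul_const _)
    · have h1 := (hlin ((wordModel hn hf hg).ν δ)).comp ih
      have h2 := differentiable_decayingSeries.comp (differentiable_snd.prodMk h1)
      have hA : Differentiable ℂ ((wordModel hn hf hg).A δ) := by
        cases δ
        · exact (axisOvershear f g hf hg * twist n).2.2
        · exact (axisOvershear f g hf hg * twist n).2.1
      have hκ : Differentiable ℂ ((wordModel hn hf hg).κ δ) := by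
        cases δ
        · exact ((hf.comp differentiable_init).neg.cexp).neg
        · exact differentiable_const 1
      exact (hA.comp ih).add (((hκ.comp ih).mul h2).smul_const _)

/-- For generic coefficients of the perturbations, the translation and the second generator are
free generators: each relation holds on a closed set of coefficients, and on a proper subset of
each suitable complex line, so that Baire's theorem applies. -/
theorem exists_lift_injective (hn : 1 ≤ n) {f g : CSpace n → ℂ} (hf : Differentiable ℂ f)
    (hg : Differentiable ℂ g) :
    ∃ (h₁ h₂ : ℂ → ℂ) (hh₁ : Differentiable ℂ h₁) (hh₂ : Differentiable ℂ h₂),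
      DecaysLeft h₁ ∧ DecaysLeft h₂ ∧ Function.Injective (FreeGroup.lift
        ![translation (baseVector n), twistedGenerator hn hf hg hh₁ hh₂]) := by
  have hdiff : ∀ x : ℕ →ᵇ ℂ, Differentiable ℂ (decayingSeries x) := fun x =>
    differentiable_decayingSeries.comp ((differentiable_const x).prodMk differentiable_id)
  set M := wordModel hn hf hg with hM
  let Z : {W : FreeGroup (Fin 2) // W ≠ 1} → Set ((ℕ →ᵇ ℂ) × (ℕ →ᵇ ℂ)) := fun W =>
    {x | ∀ z, M.eval (decayingSeries x.1) (decayingSeries x.2) W.1.toWord z = z}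
  have hclosed : ∀ W, IsClosed (Z W) := fun W => by
    have : Z W = ⋂ z, {x | M.eval (decayingSeries x.1) (decayingSeries x.2) W.1.toWord z = z} := by
      ext x; simp [Z]
    rw [this]
    exact isClosed_iInter fun z =>
      isClosed_eq (differentiable_eval hn hf hg W.1.toWord z).continuous continuous_const
  have : Countable (FreeGroup (Fin 2)) := FreeGroup.toWord_injective.countable
  by_contra! hcon
  have hcover : ⋃ W, Z W = Set.univ := by
    refine Set.eq_univ_of_forall fun x => ?_
    have h1 := hcon _ _ (hdiff x.1) (hdiff x.2) (decaysLeft_decayingSeries x.1)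
      (decaysLeft_decayingSeries x.2)
    rw [injective_iff_map_eq_one] at h1
    push Not at h1
    obtain ⟨W, hW, hW1⟩ := h1
    exact Set.mem_iUnion.2 ⟨⟨W, hW1⟩, (lift_eq_one_iff hn hf hg _ _ W).1 hW⟩
  obtain ⟨W, x₀, hx₀⟩ := nonempty_interior_of_iUnion_of_closed hclosed hcover
  -- interpolation yields coefficients for which the word acts nontrivially
  obtain ⟨p, γ, z, hz⟩ := M.exists_eval_ne (FreeGroup.isReduced_toWord (x := W.1))
    fun h => W.2 (FreeGroup.toWord_eq_nil_iff.1 h)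
  obtain ⟨S, T, hST⟩ := M.exists_finset_eval_congr p γ W.1.toWord z
  obtain ⟨y₁, hy₁⟩ := exists_decayingSeries_eqOn S p
  obtain ⟨y₂, hy₂⟩ := exists_decayingSeries_eqOn T γ
  rw [← hST _ _ hy₁ hy₂] at hz
  -- along the line from `x₀` to these coefficients, the relation would hold identically
  set y : (ℕ →ᵇ ℂ) × (ℕ →ᵇ ℂ) := (y₁, y₂) with hy
  let line : ℂ → (ℕ →ᵇ ℂ) × (ℕ →ᵇ ℂ) := fun t => x₀ + t • (y - x₀)
  have hline : Differentiable ℂ line := by fun_prop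
  have han : AnalyticOnNhd ℂ (fun t => M.eval (decayingSeries (line t).1)
      (decayingSeries (line t).2) W.1.toWord z) Set.univ := fun t _ =>
    ((differentiable_eval hn hf hg W.1.toWord z).comp hline).analyticAt t
  have hev : (fun t => M.eval (decayingSeries (line t).1) (decayingSeries (line t).2)
      W.1.toWord z) =ᶠ[𝓝 0] fun _ => z := by
    have h0 : Z W ∈ 𝓝 (line 0) := by
      rw [show line 0 = x₀ by simp [line]]
      exact mem_interior_iff_mem_nhds.1 hx₀
    filter_upwards [hline.continuous.continuousAt h0] with t ht
    exact ht z
  have heq := congrFun (han.eq_of_eventuallyEq analyticOnNhd_const hev) 1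
  rw [show line 1 = y by simp [line]] at heq
  exact hz heq

end HolAut

/-! ### Free dense subgroups with two generators -/

namespace HolAut

variable {N n : ℕ}

/-- The overshears with exponents in the class `𝓕`; shears and overshears are special cases. -/
def overshearsIn (𝓕 : Set (CSpace n → ℂ)) : Set (HolAut (n + 1)) :=
  {G | ∃ (A : Matrix.SpecialLinearGroup (Fin (n + 1)) ℂ) (f g : CSpace n → ℂ)
      (hf : Differentiable ℂ f) (hg : Differentiable ℂ g), f ∈ 𝓕 ∧
      G = (linear A)⁻¹ * axisOvershear f g hf hg * linear A}

theorem overshearsIn_zero : overshearsIn {fun _ : CSpace n => (0 : ℂ)} = shears n := by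
  refine Set.ext fun G => ⟨?_, ?_⟩
  · rintro ⟨A, f, g, hf, hg, h0, rfl⟩
    obtain rfl := Set.mem_singleton_iff.1 h0
    exact ⟨A, g, hg, rfl⟩
  · rintro ⟨A, g, hg, rfl⟩
    exact ⟨A, _, g, differentiable_const 0, hg, rfl, rfl⟩

theorem overshearsIn_entire :
    overshearsIn {f : CSpace n → ℂ | Differentiable ℂ f} = overshears n := by
  refine Set.ext fun G => ⟨?_, ?_⟩
  · rintro ⟨A, f, g, hf, hg, -, rfl⟩
    exact ⟨A, f, g, hf, hg, rfl⟩
  · rintro ⟨A, f, g, hf, hg, rfl⟩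
    exact ⟨A, f, g, hf, hg, hf, rfl⟩

theorem axisOvershear_mem_overshearsIn {𝓕 : Set (CSpace n → ℂ)} {f g : CSpace n → ℂ}
    (hf : Differentiable ℂ f) (hg : Differentiable ℂ g) (hf𝓕 : f ∈ 𝓕) :
    axisOvershear f g hf hg ∈ overshearsIn 𝓕 :=
  ⟨1, f, g, hf, hg, hf𝓕, by rw [linear_one]; group⟩

theorem conj_linear_mem_closure_overshearsIn {𝓕 : Set (CSpace n → ℂ)} {G : HolAut (n + 1)}
    (B : Matrix.SpecialLinearGroup (Fin (n + 1)) ℂ)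
    (hG : G ∈ Subgroup.closure (overshearsIn 𝓕)) :
    linear B * G * (linear B)⁻¹ ∈ Subgroup.closure (overshearsIn 𝓕) := by
  have hle : Subgroup.closure (overshearsIn 𝓕) ≤
      (Subgroup.closure (overshearsIn 𝓕)).comap (MulAut.conj (linear B)).toMonoidHom := by
    rw [Subgroup.closure_le]
    rintro _ ⟨A, f, g, hf, hg, hf𝓕, rfl⟩
    refine Subgroup.subset_closure ⟨A * B⁻¹, f, g, hf, hg, hf𝓕, ?_⟩
    simp [linear_mul, ← linear_inv, mul_assoc]
  exact hle hG

theorem linear_mem_closure_overshearsIn (hn : 1 ≤ n) {𝓕 : Set (CSpace n → ℂ)}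
    (h0 : (fun _ => 0) ∈ 𝓕) (A : Matrix.SpecialLinearGroup (Fin (n + 1)) ℂ) :
    linear A ∈ Subgroup.closure (overshearsIn 𝓕) := by
  refine linear_mem_of_axisShear hn (fun H hH => ?_) (fun g hg => Subgroup.subset_closure
    (axisOvershear_mem_overshearsIn _ hg h0)) A
  have := conj_linear_mem_closure_overshearsIn (twistSL n) hH
  rw [linear_twistSL] at this
  simpa [mul_assoc] using this

theorem twist_mem_closure_overshearsIn (hn : 1 ≤ n) {𝓕 : Set (CSpace n → ℂ)}
    (h0 : (fun _ => 0) ∈ 𝓕) : twist n ∈ Subgroup.closure (overshearsIn 𝓕) :=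
  linear_twistSL n ▸ linear_mem_closure_overshearsIn hn h0 (twistSL n)

theorem translation_mem_closure_overshearsIn (hn : 1 ≤ n) {𝓕 : Set (CSpace n → ℂ)}
    (h0 : (fun _ => 0) ∈ 𝓕) {w : CSpace (n + 1)} (hw : w ≠ 0) :
    translation w ∈ Subgroup.closure (overshearsIn 𝓕) := by
  have he : (Pi.single (Fin.last n) 1 : CSpace (n + 1)) ≠ 0 := by simp
  obtain ⟨A, hA⟩ := exists_mulVec_eq hn hw he
  refine Subgroup.subset_closure ⟨A, _, fun _ => 1, differentiable_const 0,
    differentiable_const 1, h0, ?_⟩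
  rw [← linear_conj_translation A hA]
  congr 2
  refine ext fun z => ?_
  rw [← axisShear, axisShear_apply, translation_apply, one_smul]

theorem endShear_mem_closure_overshearsIn (hn : 1 ≤ n) {𝓕 : Set (CSpace n → ℂ)}
    (h0 : (fun _ => 0) ∈ 𝓕) {h : ℂ → ℂ} (hh : Differentiable ℂ h) :
    endShear hn h hh ∈ Subgroup.closure (overshearsIn 𝓕) :=
  Subgroup.subset_closure ⟨_, _, _, differentiable_const 0, _, h0, rfl⟩

/-- A subgroup containing all products of axis overshears with the twist contains the twist itself,
hence all axis overshears, hence `SL_{n+1}`, hence every overshear. -/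
theorem closure_overshearsIn_le (hn : 1 ≤ n) {𝓕 : Set (CSpace n → ℂ)} (h0 : (fun _ => 0) ∈ 𝓕)
    {Γ : Subgroup (HolAut (n + 1))}
    (h : ∀ (f g : CSpace n → ℂ) (hf : Differentiable ℂ f) (hg : Differentiable ℂ g), f ∈ 𝓕 →
      axisOvershear f g hf hg * twist n ∈ Γ) : Subgroup.closure (overshearsIn 𝓕) ≤ Γ := by
  have htw : twist n ∈ Γ := by
    have := h _ _ (differentiable_const 0) (differentiable_const 0) h0
    rwa [axisOvershear_one, one_mul] at this
  have hax : ∀ (f g : CSpace n → ℂ) (hf : Differentiable ℂ f) (hg : Differentiable ℂ g), f ∈ 𝓕 →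
      axisOvershear f g hf hg ∈ Γ := fun f g hf hg hf𝓕 =>
    (Γ.mul_mem_cancel_right htw).1 (h f g hf hg hf𝓕)
  have hlin := linear_mem_of_axisShear hn (Γ := Γ)
    (fun H hH => by simpa [mul_assoc] using Γ.mul_mem (Γ.mul_mem htw hH) (Γ.inv_mem htw))
    (fun g hg => hax _ g _ hg h0)
  rw [Subgroup.closure_le]
  rintro _ ⟨A, f, g, hf, hg, hf𝓕, rfl⟩
  exact Γ.mul_mem (Γ.mul_mem (Γ.inv_mem (hlin A)) (hax f g hf hg hf𝓕)) (hlin A)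

theorem mem_biClosure_conj {Γ Γ' : Subgroup (HolAut N)} (Q : HolAut N)
    (h : ∀ G ∈ Γ, Q⁻¹ * G * Q ∈ Γ') {X : HolAut N} (hX : X ∈ biClosure Γ) :
    Q⁻¹ * X * Q ∈ biClosure Γ' := by
  rw [mem_biClosure_iff, biMap_mul, biMap_mul]
  have hc : Continuous fun p => biComp (biComp (biMap Q⁻¹) p) (biMap Q) :=
    continuous_biComp.comp ((continuous_biComp.comp
      (continuous_const.prodMk continuous_id)).prodMk continuous_const)
  have hmaps : Set.MapsTo (fun p => biComp (biComp (biMap Q⁻¹) p) (biMap Q))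
      (biMap '' (Γ : Set (HolAut N))) (biMap '' (Γ' : Set (HolAut N))) := by
    rintro _ ⟨G, hG, rfl⟩
    exact ⟨_, h G hG, by rw [biMap_mul, biMap_mul]⟩
  exact map_mem_closure (x := biMap X) hc hX hmaps

theorem dense_subgroupOf {H Γ : Subgroup (HolAut N)} (hle : Γ ≤ H) (h : H ≤ biClosure Γ) :
    Dense (Γ.subgroupOf H : Set H) := by
  intro x
  rw [closure_subtype]
  refine closure_mono ?_ (mem_closure_of_mem_biClosure (h x.2))
  exact fun G hG => ⟨⟨G, hle hG⟩, hG, rfl⟩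

/-- The two parts of the result at once, for overshears with exponents in a class `𝓕`. -/
theorem exists_isFreeDensePair (hn : 1 ≤ n) {𝓕 : Set (CSpace n → ℂ)} (h𝓕 : IsExponentClass 𝓕)
    {w : CSpace (n + 1)} (hw : w ≠ 0) :
    ∃ F : HolAut (n + 1),
      (∃ G ∈ overshearsIn 𝓕, ConjugateIn (Subgroup.closure (overshearsIn 𝓕)) F (G * twist n)) ∧
      IsFreeDensePair (Subgroup.closure (overshearsIn 𝓕)) (translation w) F := by
  obtain ⟨f, g, hf, hg, hf𝓕, hdense⟩ := exists_axisOvershear_mul_twist_mem hn h𝓕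
  obtain ⟨h₁, h₂, hh₁, hh₂, hd₁, hd₂, hinj⟩ := exists_lift_injective hn hf hg
  replace hdense := hdense h₁ h₂ hh₁ hh₂ hd₁ hd₂
  have hg' : Differentiable ℂ fun y => g y + h₂ (coordSum n y) :=
    hg.add (hh₂.comp differentiable_coordSum)
  have hF₀ : twistedGenerator hn hf hg hh₁ hh₂ = (endShear hn h₁ hh₁)⁻¹ *
    (axisOvershear f (fun y => g y + h₂ (coordSum n y)) hf hg' * twist n) *
      endShear hn h₁ hh₁ := rfl
  generalize twistedGenerator hn hf hg hh₁ hh₂ = F₀ at hinj hdense hF₀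
  have hb : baseVector n ≠ 0 := fun h => by simpa [baseVector] using congrFun h 0
  obtain ⟨B, hB⟩ := exists_mulVec_eq hn hw hb
  have hτ := linear_conj_translation B hB
  set H := Subgroup.closure (overshearsIn 𝓕) with hH
  have h0 := h𝓕.zero_mem
  have hBH : linear B ∈ H := linear_mem_closure_overshearsIn hn h0 B
  have hPH : endShear hn h₁ hh₁ ∈ H := endShear_mem_closure_overshearsIn hn h0 hh₁
  have hGmem := axisOvershear_mem_overshearsIn hf hg' hf𝓕
  have hF₀H : F₀ ∈ H := by
    rw [hF₀]
    exact H.mul_mem (H.mul_mem (H.inv_mem hPH) (H.mul_mem (Subgroup.subset_closure hGmem)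
      (twist_mem_closure_overshearsIn hn h0))) hPH
  have hle : Subgroup.closure {translation w, (linear B)⁻¹ * F₀ * linear B} ≤ H := by
    rw [Subgroup.closure_le]
    rintro _ (rfl | rfl)
    · exact translation_mem_closure_overshearsIn hn h0 hw
    · exact H.mul_mem (H.mul_mem (H.inv_mem hBH) hF₀H) hBH
  refine ⟨(linear B)⁻¹ * F₀ * linear B, ⟨_, hGmem, endShear hn h₁ hh₁ * linear B,
    H.mul_mem hPH hBH, ?_⟩, hle, ?_, dense_subgroupOf hle fun X hX => ?_⟩
  · rw [hF₀]; group
  · have h : FreeGroup.lift ![translation w, (linear B)⁻¹ * F₀ * linear B] =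
        (MulAut.conj (linear B)⁻¹).toMonoidHom.comp
          (FreeGroup.lift ![translation (baseVector n), F₀]) := by
      refine FreeGroup.ext_hom _ _ fun i => ?_
      fin_cases i
      · simp [← hτ]
      · simp
    rw [h]
    exact (MulAut.conj (linear B)⁻¹).injective.comp hinj
  · have hX' := closure_overshearsIn_le hn h0 hdense (conj_linear_mem_closure_overshearsIn B hX)
    have hconj : Subgroup.closure {translation (baseVector n), F₀} ≤
        (Subgroup.closure {translation w, (linear B)⁻¹ * F₀ * linear B}).comap
          (MulAut.conj (linear B)⁻¹).toMonoidHom := by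
      rw [Subgroup.closure_le]
      rintro _ (rfl | rfl)
      · exact Subgroup.subset_closure (by simp [← hτ])
      · exact Subgroup.subset_closure (by simp)
    have := mem_biClosure_conj (linear B)
      (fun G hG => by simpa using hconj hG) hX'
    simpa [mul_assoc] using this

end HolAut

theorem mainTheorem3 (n : ℕ) (hn : 1 ≤ n) (w : CSpace (n + 1)) (hw : w ≠ 0) :
    (∃ F : HolAut (n + 1),
      (∃ T ∈ HolAut.twistedShears n, HolAut.ConjugateIn (HolAut.shearGroup n) F T) ∧
      HolAut.IsFreeDensePair (HolAut.shearGroup n) (HolAut.translation w) F) ∧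
    (∃ F : HolAut (n + 1),
      (∃ T ∈ HolAut.twistedOvershears n, HolAut.ConjugateIn (HolAut.overshearGroup n) F T) ∧
      HolAut.IsFreeDensePair (HolAut.overshearGroup n) (HolAut.translation w) F) := by
  have hs := HolAut.exists_isFreeDensePair hn HolAut.isExponentClass_zero hw
  have ho := HolAut.exists_isFreeDensePair hn (HolAut.isExponentClass_entire hn) hw
  rw [HolAut.overshearsIn_zero] at hs
  rw [HolAut.overshearsIn_entire] at ho
  obtain ⟨F, ⟨G, hG, hc⟩, hF⟩ := hs
  obtain ⟨F', ⟨G', hG', hc'⟩, hF'⟩ := ho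
  exact ⟨⟨F, ⟨_, ⟨G, hG, rfl⟩, hc⟩, hF⟩, ⟨F', ⟨_, ⟨G', hG', rfl⟩, hc'⟩, hF'⟩⟩
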